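/- Let $G$ be a finite group. For an inverse-closed subset $S\subseteq G\setminus\{1\}$, the Cayley graph $\mathrm{Cay}(G,S)$ is the graph with vertex set $G$ in which $g,h$ are adjacent if and only if $hg^{-1}\in S$. A graph $\Gamma$ is a graphical regular representation (GRR) of $G$ if its automorphism group $\mathrm{Aut}(\Gamma)$ acts regularly on the vertex set of $\Gamma$ and is isomorphic to $G$. For an integer $k\ge 5$ and elements $x,y\in G$ of orders $|x|>2\lfloor (k-1)/2\rfloor$ and $|y|=2$, let $$\Gamma_k(G,x,y)=\begin{cases}\mathrm{Cay}\bigl(G,\{x^{\pm1},x^{\pm2},\dots,x^{\pm(k-1)/2},\,y\}\bigr)&\text{if } k \text{ is odd},\\ \mathrm{Cay}\bigl(G,\{x^{\pm1},x^{\pm2},\dots,x^{\pm(k-2)/2},\,y,\,x^{-1}yx\}\bigr)&\text{if } k\text{ is even}.\end{cases}$$ Theorem. Let $k\ge 5$ be an integer, let $A_n$ be the alternating group of degree $n$ with $n\ge\max\{14,\,6\lceil k/2\rceil-12\}$, and let $p$ be a prime such that $(n+4)/2<p\le n-3$. Then for each element $x$ of order $p$ in $A_n$ there exists an involution $y$ in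 $A_n$ such that $\Gamma_k(A_n,x,y)$ is a GRR of $A_n$. (Under these hypotheses $p>2\lfloor (k-1)/2\rfloor$, so $\Gamma_k(A_n,x,y)$ is defined.) -/

import Mathlib

/-- The Cayley graph `Cay(G, S)`: the vertex set is `G`, and distinct `g, h` are adjacent if and only
if `h * g⁻¹ ∈ S` or `g * h⁻¹ ∈ S`. For an inverse-closed connection set `S` of non-identity elements
this is the usual rule `h * g⁻¹ ∈ S`, see `cayleyGraph_adj_iff`. -/
def cayleyGraph {G : Type*} [Group G] (S : Set G) : SimpleGraph G :=
  SimpleGraph.fromRel (fun g h => h * g⁻¹ ∈ S)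

theorem cayleyGraph_adj_iff {G : Type*} [Group G] (S : Set G)
    (hinv : ∀ s ∈ S, s⁻¹ ∈ S) (hone : (1 : G) ∉ S) (g h : G) :
    (cayleyGraph S).Adj g h ↔ h * g⁻¹ ∈ S := by
  simp only [cayleyGraph, SimpleGraph.fromRel_adj]
  constructor
  · rintro ⟨-, h1 | h1⟩
    · exact h1
    · simpa using hinv _ h1
  · intro h1
    refine ⟨?_, Or.inl h1⟩
    rintro rfl
    exact hone (by simpa using h1)

/-- The set `{x^{±1}, …, x^{±⌊(k-1)/2⌋}, y}` if `k` is odd, and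
`{x^{±1}, …, x^{±⌊(k-1)/2⌋}, y, x⁻¹ y x}` if `k` is even. -/
def connectionSet {G : Type*} [Group G] (k : ℕ) (x y : G) : Set G :=
  {g | ∃ j : ℕ, 1 ≤ j ∧ j ≤ (k - 1) / 2 ∧ (g = x ^ j ∨ g = (x ^ j)⁻¹)} ∪
    (if Odd k then {y} else {y, x⁻¹ * y * x})

theorem inv_mem_connectionSet {G : Type*} [Group G] (k : ℕ) (x y : G) (hy : orderOf y = 2)
    (s : G) (hs : s ∈ connectionSet k x y) : s⁻¹ ∈ connectionSet k x y := by
  have hyy : y⁻¹ = y := by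
    have h : y ^ 2 = 1 := hy ▸ pow_orderOf_eq_one y
    exact inv_eq_of_mul_eq_one_left (by rwa [pow_two] at h)
  rcases hs with ⟨j, h1, h2, rfl | rfl⟩ | hs
  · exact Or.inl ⟨j, h1, h2, Or.inr rfl⟩
  · exact Or.inl ⟨j, h1, h2, Or.inl (inv_inv _)⟩
  · right
    split_ifs at hs ⊢ with hk
    · rw [Set.mem_singleton_iff] at hs ⊢
      rw [hs, hyy]
    · rcases hs with rfl | hs
      · exact Or.inl hyy
      · rw [Set.mem_singleton_iff] at hs
        right
        rw [hs, Set.mem_singleton_iff]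
        simp [mul_assoc, hyy]

theorem one_notMem_connectionSet {G : Type*} [Group G] (k : ℕ) (x y : G)
    (hx : 2 * ((k - 1) / 2) < orderOf x) (hy : orderOf y = 2) : (1 : G) ∉ connectionSet k x y := by
  have hy1 : y ≠ 1 := by
    rintro rfl
    simp at hy
  have hpow (j : ℕ) (h1 : 1 ≤ j) (h2 : j ≤ (k - 1) / 2) : x ^ j ≠ 1 :=
    pow_ne_one_of_lt_orderOf (by omega) (by omega)
  rintro (⟨j, h1, h2, h | h⟩ | hs)
  · exact hpow j h1 h2 h.symm
  · exact hpow j h1 h2 (inv_eq_one.mp h.symm)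
  · split_ifs at hs with hk
    · exact hy1 (Set.mem_singleton_iff.mp hs).symm
    · rcases hs with h | h
      · exact hy1 h.symm
      · rw [Set.mem_singleton_iff] at h
        apply hy1
        have h' : x * 1 * x⁻¹ = y := by
          rw [h]
          group
        simpa using h'.symm

/-- The Cayley graph `Γ_k(G, x, y)`. -/
def gammaGraph {G : Type*} [Group G] (k : ℕ) (x y : G) : SimpleGraph G :=
  cayleyGraph (connectionSet k x y)

/-- `Γ` is a graphical regular representation of `G`: the automorphism group of `Γ` acts regularly
on the vertex set and is isomorphic to `G`. -/
def IsGRR {V : Type*} (Γ : SimpleGraph V) (G : Type*) [Group G] : Prop :=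
  (∀ u v : V, ∃! σ : Γ ≃g Γ, σ u = v) ∧ Nonempty ((Γ ≃g Γ) ≃* G)

/-! Write m = ⌊(k-1)/2⌋ and q = n - p. The bounds on n and p give 3m < p. Then an edge labelled
x^{±j} lies in exactly 2m-1-j triangles, while edges labelled by y or x⁻¹yx lie in none. So every
graph automorphism preserves the x^{±1}-edges and the edges labelled by these involutions. Let σ be
an automorphism fixing the vertex 1. It is trivial whenever the group is finite and simple,
generated by x and y, and no group automorphism inverts x and fixes y (`isGRR_gammaGraph`).

For k even, the quadrangle c, yc, x⁻¹yc, x⁻¹c forces σ to keep all x-edges directed the same way or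
to reverse them all. In the first case σ is trivial; in the second it is a group automorphism which,
followed by conjugation by x, inverts x and fixes y.

For k odd, the stabilizer T of 1 is a 2-group. Its subgroup Q fixing x has index at most 2 and is
normalized by the right multiplication X by x; T is normalized by the right multiplication Y by y;
no nontrivial subgroup of T is normalized by both. A Thompson-subgroup argument gives |T| ≤ 4
(`card_le_four_of_amalgam`). So the right multiplications have index at most 4. An element of order
p ≥ 5 acts trivially on their cosets, and simplicity makes them normal, so σ is a group automorphism
fixing y and sending x to x^{±1}.

To choose y: since 2p > n, x is a p-cycle with q ≥ 3 fixed points. Let y exchange these with q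
consecutive points of the cycle, move the next point and fix the preceding one. Then ⟨x, y⟩ is
transitive, and a Jordan-type theorem (`alternatingGroup_le_of_isCycle_mem`) gives generation. An
automorphism inverting x comes from a permutation (`exists_perm_of_mulEquiv`), which reflects the
cycle. Fixing y, it would preserve the interval and swap its two neighbours, of which y fixes only
one. -/

/-! ### Bounding a 2-group by a Thompson-subgroup argument -/

section Amalgam

variable {A : Type*} [Group A]

/-- A subgroup containing coprime powers of an element contains the element. -/
theorem Subgroup.mem_of_pow_mem_of_coprime {H : Subgroup A} {g : A} {a b : ℕ}
    (hab : a.Coprime b) (ha : g ^ a ∈ H) (hb : g ^ b ∈ H) : g ∈ H := by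
  have h := Nat.gcd_eq_gcd_ab a b
  rw [hab.gcd_eq_one] at h
  have : g = (g ^ a) ^ (a.gcdA b) * (g ^ b) ^ (a.gcdB b) := by
    rw [← zpow_natCast, ← zpow_natCast, ← zpow_mul, ← zpow_mul, ← zpow_add, ← h]
    simp
  rw [this]
  exact H.mul_mem (H.zpow_mem ha _) (H.zpow_mem hb _)

/-- A subgroup `Q` of `T` such that products of elements of `T` outside `Q` lie in `Q` has at least
half the order of `T`. The same holds for the intersections with any subgroup of `T`. -/
theorem Subgroup.card_le_two_mul_card_inf [Finite A] {T Q E : Subgroup A} (hET : E ≤ T)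
    (hindex : ∀ s ∈ T, ∀ t ∈ T, s ∉ Q → t ∉ Q → s * t ∈ Q) :
    Nat.card E ≤ 2 * Nat.card (E ⊓ Q : Subgroup A) := by
  by_cases hEQ : E ≤ Q
  · rw [inf_eq_left.2 hEQ]; omega
  obtain ⟨t, htE, htQ⟩ := SetLike.not_le_iff_exists.1 hEQ
  classical
  -- Multiplying by a fixed t in E outside Q sends the rest of E outside Q into E ⊓ Q; the flag
  -- records which case occurred.
  let f : E → Bool × (E ⊓ Q : Subgroup A) := fun g =>
    if h : (g : A) ∈ Q then (true, ⟨g, g.2, h⟩)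
    else (false, ⟨t * g, E.mul_mem htE g.2, hindex t (hET htE) g (hET g.2) htQ h⟩)
  have hf : Function.Injective f := by
    intro a b hab
    by_cases ha : (a : A) ∈ Q <;> by_cases hb : (b : A) ∈ Q <;>
      simp [f, ha, hb] at hab
    · exact Subtype.ext (by simpa using congrArg Subtype.val hab)
    · exact Subtype.ext (by simpa using congrArg Subtype.val hab)
  simpa using Nat.card_le_card_of_injective f hf

/-- Two elements of a subgroup lying outside a smaller subgroup of at least half its size differ
by an element of the smaller subgroup. -/
theorem Subgroup.inv_mul_mem_of_card_le_two_mul [Finite A] {E F : Subgroup A} (hEF : E ≤ F)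
    (hcard : Nat.card F ≤ 2 * Nat.card E) {v w : A} (hv : v ∈ F) (hw : w ∈ F)
    (hvE : v ∉ E) (hwE : w ∉ E) : v⁻¹ * w ∈ E := by
  have hmul := Subgroup.card_mul_index (E.subgroupOf F)
  have hE : Nat.card (E.subgroupOf F) = Nat.card E :=
    Nat.card_congr (Subgroup.subgroupOfEquivOfLe hEF).toEquiv
  rw [hE] at hmul
  have hpos : 0 < Nat.card E := Nat.card_pos
  have hle : (E.subgroupOf F).index ≤ 2 := by
    rw [← hmul, mul_comm] at hcard
    exact Nat.le_of_mul_le_mul_right hcard hpos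
  have hne : (E.subgroupOf F).index ≠ 0 := Subgroup.index_ne_zero_of_finite
  have hne1 : (E.subgroupOf F).index ≠ 1 := by
    intro h
    rw [Subgroup.index_eq_one] at h
    exact hvE (by
      have : (⟨v, hv⟩ : F) ∈ E.subgroupOf F := by rw [h]; trivial
      simpa [Subgroup.mem_subgroupOf] using this)
  have h2 : (E.subgroupOf F).index = 2 := by omega
  have := (Subgroup.mul_mem_iff_of_index_two h2 (a := (⟨v, hv⟩ : F)⁻¹) (b := ⟨w, hw⟩)).2 (by
    rw [inv_mem_iff]
    simp [Subgroup.mem_subgroupOf, hvE, hwE])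
  simpa [Subgroup.mem_subgroupOf] using this

/-- If `t` inverts `X` modulo `Q`, then an element commuting with `t`, with `X * t * X⁻¹` and with
`Q` commutes with `X`, provided that `X` normalizes `Q` and has odd order. -/
theorem commute_of_inverting {Q : Subgroup A} {X t v : A} {p : ℕ} (hp : p.Coprime 2)
    (hX : X ^ p = 1) (hXQ : ∀ g ∈ Q, X * g * X⁻¹ ∈ Q) (htX : X * t * X * t⁻¹ ∈ Q)
    (hvt : Commute v t) (hvt' : Commute v (X * t * X⁻¹)) (hvQ : ∀ g ∈ Q, Commute v g) :
    Commute v X := by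
  have h1 : Commute v (X * (X * t * X * t⁻¹) * X⁻¹) := hvQ _ (hXQ _ htX)
  -- X² is an element of Q times the commutator of X and t. Both factors commute with v, and odd
  -- order passes this from X² to X.
  have h2 : X ^ 2 = (X * (X * t * X * t⁻¹) * X⁻¹) * ((X * t * X⁻¹) * t⁻¹) := by
    rw [pow_two]; group
  have h3 : Commute v (X ^ 2) := by
    rw [h2]
    exact h1.mul_right (hvt'.mul_right hvt.inv_right)
  have := Subgroup.mem_of_pow_mem_of_coprime (H := Subgroup.centralizer {v}) (g := X) hp
    (by rw [hX]; exact one_mem _) (by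
      rw [Subgroup.mem_centralizer_singleton_iff]; exact h3.symm)
  rw [Subgroup.mem_centralizer_singleton_iff] at this
  exact Commute.symm this

/-- If `t` inverts `X` modulo a `2`-group `Q` and centralizes `Q`, then `X` centralizes `Q`. -/
theorem commute_of_inverting_of_centralizing {Q : Subgroup A} (hQ : IsPGroup 2 Q) {X t : A} {p : ℕ}
    (hp : p.Coprime 2) (hX : X ^ p = 1) (hXQ : ∀ g ∈ Q, X * g * X⁻¹ ∈ Q)
    (hXQ' : ∀ g ∈ Q, X⁻¹ * g * X ∈ Q)
    (htX : X * t * X * t⁻¹ ∈ Q) (htQ : ∀ g ∈ Q, Commute t g) : ∀ g ∈ Q, Commute X g := by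
  set c := X * (X * t * X * t⁻¹) * X⁻¹ with hc
  set u := (X * t * X⁻¹) * t⁻¹ with hu
  have hcQ : c ∈ Q := hXQ _ htX
  have ht' : ∀ g ∈ Q, Commute (X * t * X⁻¹) g := by
    intro g hg
    have h := htQ _ (hXQ' g hg)
    have h' : X * (t * (X⁻¹ * g * X)) * X⁻¹ = X * ((X⁻¹ * g * X) * t) * X⁻¹ := by rw [h.eq]
    have e1 : X * (t * (X⁻¹ * g * X)) * X⁻¹ = X * t * X⁻¹ * g := by group
    have e2 : X * ((X⁻¹ * g * X) * t) * X⁻¹ = g * (X * t * X⁻¹) := by group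
    exact e1.symm.trans (h'.trans e2)
  have huQ : ∀ g ∈ Q, Commute u g := fun g hg => (ht' g hg).mul_left (htQ g hg).inv_left
  have h2 : X ^ 2 = c * u := by rw [hc, hu, pow_two]; group
  obtain ⟨k, hk⟩ := hQ ⟨c, hcQ⟩
  have hk' : c ^ 2 ^ k = 1 := by simpa using congrArg (Subtype.val) hk
  -- The factors c and u of X² commute, so a 2-power kills c and leaves a power of u, which
  -- centralizes Q.
  have h3 : X ^ (2 * 2 ^ k) = u ^ 2 ^ k := by
    rw [pow_mul, h2, (huQ c hcQ).symm.mul_pow, hk', one_mul]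
  intro g hg
  have := Subgroup.mem_of_pow_mem_of_coprime (H := Subgroup.centralizer {g}) (g := X)
    (a := p) (b := 2 * 2 ^ k) (by rw [← pow_succ']; exact hp.pow_right _)
    (by rw [hX]; exact one_mem _) (by
      rw [Subgroup.mem_centralizer_singleton_iff, h3]; exact (huQ g hg).pow_left _)
  rwa [Subgroup.mem_centralizer_singleton_iff] at this

/-- The conjugates of a subgroup normalized by an element of finite order under its inverse. -/
theorem inv_conj_mem_of_pow_eq_one {Q : Subgroup A} {X : A} {p : ℕ} (hp : 0 < p) (hX : X ^ p = 1)
    (hXQ : ∀ g ∈ Q, X * g * X⁻¹ ∈ Q) : ∀ g ∈ Q, X⁻¹ * g * X ∈ Q := by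
  have hpow : ∀ (i : ℕ), ∀ g ∈ Q, X ^ i * g * (X ^ i)⁻¹ ∈ Q := by
    intro i
    induction i with
    | zero => intro g hg; simpa using hg
    | succ i ih =>
      intro g hg
      have := hXQ _ (ih g hg)
      rw [pow_succ']
      simpa [mul_assoc] using this
  have h : X⁻¹ = X ^ (p - 1) := by
    rw [inv_eq_iff_mul_eq_one, ← pow_succ', Nat.sub_add_cancel hp, hX]
  intro g hg
  have := hpow (p - 1) g hg
  rwa [← h, inv_inv] at this

/-- If an element `t` centralizes a subgroup of index at most two of an abelian `2`-group `V` on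
which `X`, of prime order at least five modulo the centralizer, acts, and if `t` inverts `X` modulo
a group `Q` centralizing `V`, then `X` centralizes `V`. -/
theorem commute_of_index_two {Q V : Subgroup A} (hV : IsPGroup 2 V)
    {X t : A} {p : ℕ} (hp : p.Prime) (h5 : 5 ≤ p) (hX : X ^ p = 1)
    (hXQ : ∀ g ∈ Q, X * g * X⁻¹ ∈ Q) (hXV : ∀ g ∈ V, X * g * X⁻¹ ∈ V)
    (hQV : ∀ v ∈ V, ∀ g ∈ Q, Commute v g) (htX : X * t * X * t⁻¹ ∈ Q)
    (hindex : ∀ v ∈ V, ∀ w ∈ V, ¬ Commute v t → ¬ Commute w t → Commute (v⁻¹ * w) t) :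
    ∀ v ∈ V, Commute v X := by
  classical
  have hp2 : p.Coprime 2 := (Nat.coprime_primes hp Nat.prime_two).2 (by omega)
  have hXV' := inv_conj_mem_of_pow_eq_one hp.pos hX hXV
  have hsame : ∀ v ∈ V, ∀ w ∈ V, (Commute v t ↔ Commute w t) → Commute (v⁻¹ * w) t := by
    intro v hv w hw h
    by_cases hvt : Commute v t
    · exact hvt.inv_left.mul_left (h.1 hvt)
    · exact hindex v hv w hw hvt (fun h' => hvt (h.2 h'))
  have hconj : ∀ a b : A, Commute a (X * b * X⁻¹) ↔ Commute (X⁻¹ * a * X) b := by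
    intro a b
    constructor
    · intro h
      have := congrArg (fun g => X⁻¹ * g * X) h.eq
      simp only [mul_assoc, inv_mul_cancel_left, inv_mul_cancel, mul_one] at this
      simpa only [Commute, SemiconjBy, mul_assoc] using this
    · intro h
      have := congrArg (fun g => X * g * X⁻¹) h.eq
      simp only [mul_assoc, mul_inv_cancel_left, mul_inv_cancel, mul_one] at this
      simpa only [Commute, SemiconjBy, mul_assoc] using this
  have hpowV : ∀ (i : ℕ), ∀ g ∈ V, X ^ i * g * (X ^ i)⁻¹ ∈ V := by
    intro i
    induction i with
    | zero => intro g hg; simpa using hg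
    | succ i ih =>
      intro g hg
      have := hXV _ (ih g hg)
      rw [pow_succ']
      simpa [mul_assoc] using this
  intro v hv
  -- The centralizers of t and of X t X⁻¹ each have at most two cosets in V, so two of five
  -- successive conjugates of v share both.
  let f : Fin 5 → Bool × Bool := fun i =>
    (decide (Commute (X ^ (i : ℕ) * v * (X ^ (i : ℕ))⁻¹) t),
      decide (Commute (X ^ (i : ℕ) * v * (X ^ (i : ℕ))⁻¹) (X * t * X⁻¹)))
  obtain ⟨i, j, hij, hfij⟩ := Fintype.exists_ne_map_eq_of_card_lt f (by simp)
  wlog hlt : i < j generalizing i j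
  · exact this j i hij.symm hfij.symm (lt_of_le_of_ne (not_lt.1 hlt) hij.symm)
  obtain ⟨hf1, hf2⟩ := Prod.ext_iff.1 hfij
  simp only [f, decide_eq_decide] at hf1 hf2
  set a := X ^ (i : ℕ) * v * (X ^ (i : ℕ))⁻¹ with ha
  set b := X ^ (j : ℕ) * v * (X ^ (j : ℕ))⁻¹ with hb
  have haV : a ∈ V := hpowV _ _ hv
  have hbV : b ∈ V := hpowV _ _ hv
  have h1 : Commute (a⁻¹ * b) t := hsame a haV b hbV hf1
  have h2 : Commute (a⁻¹ * b) (X * t * X⁻¹) := by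
    rw [hconj] at hf2 ⊢
    rw [hconj] at hf2
    have := hsame _ (hXV' a haV) _ (hXV' b hbV) hf2
    have e : X⁻¹ * (a⁻¹ * b) * X = (X⁻¹ * a * X)⁻¹ * (X⁻¹ * b * X) := by group
    rwa [e]
  have hcX : Commute (a⁻¹ * b) X := commute_of_inverting hp2 hX hXQ htX h1 h2
    (hQV _ (V.mul_mem (V.inv_mem haV) hbV))
  set c := a⁻¹ * b with hc
  obtain ⟨d, hd⟩ := Nat.exists_eq_add_of_lt hlt
  set e := d + 1 with he
  have hbe : b = X ^ e * a * (X ^ e)⁻¹ := by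
    have : (j : ℕ) = e + i := by omega
    rw [hb, ha, this, pow_add]
    group
  have hstep : X ^ e * a * (X ^ e)⁻¹ = a * c := by rw [← hbe, hc, mul_inv_cancel_left]
  -- As c commutes with X, iterating conjugation by X ^ e multiplies a by powers of c. After p steps
  -- c ^ p = 1, so c = 1 in the 2-group V.
  have hiter : ∀ s : ℕ, (X ^ e) ^ s * a * ((X ^ e) ^ s)⁻¹ = a * c ^ s := by
    intro s
    induction s with
    | zero => simp
    | succ s ih =>
      have : (X ^ e) ^ (s + 1) * a * ((X ^ e) ^ (s + 1))⁻¹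
          = X ^ e * ((X ^ e) ^ s * a * ((X ^ e) ^ s)⁻¹) * (X ^ e)⁻¹ := by
        rw [pow_succ']; group
      have hce : X ^ e * c ^ s * (X ^ e)⁻¹ = c ^ s := by
        rw [((hcX.symm.pow_left e).pow_right s).eq, mul_inv_cancel_right]
      have e2 : X ^ e * (a * c ^ s) * (X ^ e)⁻¹
          = (X ^ e * a * (X ^ e)⁻¹) * (X ^ e * c ^ s * (X ^ e)⁻¹) := by group
      rw [this, ih, e2, hstep, hce, pow_succ', mul_assoc]
  have hcp : c ^ p = 1 := by
    have := hiter p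
    rw [← pow_mul, mul_comm e p, pow_mul, hX, one_pow] at this
    simpa using this.symm
  have hc1 : c = 1 := by
    obtain ⟨k, hk⟩ := hV ⟨c, V.mul_mem (V.inv_mem haV) hbV⟩
    have hk' : c ^ 2 ^ k = 1 := by simpa using congrArg Subtype.val hk
    have := Subgroup.mem_of_pow_mem_of_coprime (H := (⊥ : Subgroup A)) (g := c)
      (hp2.pow_right k) (by simpa using hcp) (by simpa using hk')
    simpa using this
  have hae : Commute a (X ^ e) := by
    have := hstep
    rw [hc1, mul_one, mul_inv_eq_iff_eq_mul] at this
    exact this.symm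
  have hve : Commute v (X ^ e) := by
    have h3 : a * X ^ e = X ^ e * a := hae
    have h4 := congrArg (fun g => (X ^ (i : ℕ))⁻¹ * g * X ^ (i : ℕ)) h3
    have e3 : (X ^ (i : ℕ))⁻¹ * (a * X ^ e) * X ^ (i : ℕ) = v * X ^ e := by
      rw [ha]; group
    have e4 : (X ^ (i : ℕ))⁻¹ * (X ^ e * a) * X ^ (i : ℕ) = X ^ e * v := by
      rw [ha]; group
    exact e3.symm.trans (h4.trans e4)
  -- Here 0 < e ≤ 4 < p, which is where `5 ≤ p` enters.
  have hcop : p.Coprime e := by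
    rw [hp.coprime_iff_not_dvd]
    intro hdvd
    have := Nat.le_of_dvd (by omega) hdvd
    have := j.isLt
    omega
  have := Subgroup.mem_of_pow_mem_of_coprime (H := Subgroup.centralizer {v}) (g := X) hcop
    (by rw [hX]; exact one_mem _) (by
      rw [Subgroup.mem_centralizer_singleton_iff]; exact hve.symm)
  rw [Subgroup.mem_centralizer_singleton_iff] at this
  exact Commute.symm this

/-- An abelian subgroup of `T` of the greatest possible order. -/
def IsLargestAbelian (T E : Subgroup A) : Prop :=
  E ≤ T ∧ (∀ a ∈ E, ∀ b ∈ E, Commute a b) ∧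
    ∀ F ≤ T, (∀ a ∈ F, ∀ b ∈ F, Commute a b) → Nat.card F ≤ Nat.card E

theorem exists_isLargestAbelian [Finite A] (T : Subgroup A) : ∃ E, IsLargestAbelian T E := by
  have hfin : {F : Subgroup A | F ≤ T ∧ ∀ a ∈ F, ∀ b ∈ F, Commute a b}.Finite := Set.toFinite _
  obtain ⟨E, hE, hmax⟩ := hfin.exists_maximalFor (fun F : Subgroup A => Nat.card F) _
    ⟨⊥, bot_le, by
      intro a ha b hb
      rw [Subgroup.mem_bot] at ha
      rw [ha]; exact Commute.one_left b⟩
  refine ⟨E, hE.1, hE.2, fun F hF hFc => ?_⟩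
  rcases le_total (Nat.card F) (Nat.card E) with h | h
  · exact h
  · exact hmax ⟨hF, hFc⟩ h

theorem IsLargestAbelian.map_conj {T E : Subgroup A} (hE : IsLargestAbelian T E) {g : A}
    (hg : ∀ a ∈ E, g * a * g⁻¹ ∈ T) :
    IsLargestAbelian T (E.map (MulAut.conj g).toMonoidHom) := by
  refine ⟨?_, ?_, ?_⟩
  · rintro _ ⟨a, ha, rfl⟩
    exact hg a ha
  · rintro _ ⟨a, ha, rfl⟩ _ ⟨b, hb, rfl⟩
    exact (hE.2.1 a ha b hb).map _
  · intro F hF hFc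
    rw [Subgroup.card_map_of_injective (MulAut.conj g).injective]
    exact hE.2.2 F hF hFc

/-- A `2`-group `T` with a subgroup `Q` of index at most two, such that an element `X` of prime
order at least five normalizes `Q` and is inverted modulo `Q` by `T`, and an involution `Y`
normalizes `T`, has order at most four if no nontrivial subgroup of `T` is normalized by both `X`
and `Y`. -/
theorem card_le_four_of_amalgam [Finite A] {T Q : Subgroup A} (hQT : Q ≤ T) (hT : IsPGroup 2 T)
    {X Y : A} {p : ℕ} (hp : p.Prime) (h5 : 5 ≤ p) (hX : X ^ p = 1) (hY : Y * Y = 1)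
    (hXQ : ∀ g ∈ Q, X * g * X⁻¹ ∈ Q) (hYT : ∀ g ∈ T, Y * g * Y⁻¹ ∈ T)
    (hindex : ∀ s ∈ T, ∀ t ∈ T, s ∉ Q → t ∉ Q → s * t ∈ Q)
    (hinv : ∀ t ∈ T, t ∉ Q → X * t * X * t⁻¹ ∈ Q)
    (hcore : ∀ K ≤ T, (∀ g ∈ K, X * g * X⁻¹ ∈ K) → (∀ g ∈ K, Y * g * Y⁻¹ ∈ K) → K = ⊥) :
    Nat.card T ≤ 4 := by
  have hp2 : p.Coprime 2 := (Nat.coprime_primes hp Nat.prime_two).2 (by omega)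
  have hXQ' := inv_conj_mem_of_pow_eq_one hp.pos hX hXQ
  have hQ : IsPGroup 2 Q := hT.to_le hQT
  have hYinv : Y⁻¹ = Y := inv_eq_of_mul_eq_one_left hY
  have hcardT : Nat.card T ≤ 2 * Nat.card Q := by
    have := Subgroup.card_le_two_mul_card_inf (le_refl T) hindex
    rwa [inf_eq_right.2 hQT] at this
  by_cases hZ : T ⊓ Subgroup.centralizer T ≤ Q
  · -- the centre of `T` lies in `Q`
    suffices T = ⊥ by rw [this]; simp
    -- If every largest abelian subgroup lies in Q, their join (the Thompson subgroup) is normalized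
    -- by X as well as by Y, hence trivial. Cyclic subgroups of T are then trivial too.
    by_cases hJ : ∀ E, IsLargestAbelian T E → E ≤ Q
    · have hbot : ∀ E, IsLargestAbelian T E → E = ⊥ := by
        have hconj : ∀ g : A, (∀ E, IsLargestAbelian T E → ∀ a ∈ E, g * a * g⁻¹ ∈ T) →
            ∀ a ∈ sSup {E | IsLargestAbelian T E}, g * a * g⁻¹ ∈ sSup {E | IsLargestAbelian T E} := by
          intro g hg
          suffices sSup {E | IsLargestAbelian T E}
              ≤ (sSup {E | IsLargestAbelian T E}).comap (MulAut.conj g).toMonoidHom from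
            fun a ha => this ha
          refine sSup_le fun E hE => ?_
          rw [← Subgroup.map_le_iff_le_comap]
          exact le_sSup (hE.map_conj (hg E hE))
        have := hcore (sSup {E | IsLargestAbelian T E}) (sSup_le fun E hE => hE.1)
          (hconj X fun E hE a ha => hQT (hXQ a (hJ E hE ha)))
          (hconj Y fun E hE a ha => hYT a (hE.1 ha))
        intro E hE
        rw [eq_bot_iff, ← this]
        exact le_sSup hE
      obtain ⟨E, hE⟩ := exists_isLargestAbelian T
      rw [eq_bot_iff]
      intro t ht
      have hcard := hE.2.2 (Subgroup.zpowers t) (by simpa using ht) (by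
        rintro _ ⟨i, rfl⟩ _ ⟨j, rfl⟩
        exact ((Commute.refl t).zpow_left i).zpow_right j)
      rw [hbot E hE, Subgroup.card_bot, Nat.card_zpowers] at hcard
      have hpos := orderOf_pos t
      rw [Subgroup.mem_bot, ← orderOf_eq_one_iff]
      omega
    · push Not at hJ
      obtain ⟨E, hE, hEQ⟩ := hJ
      obtain ⟨t, htE, htQ⟩ := SetLike.not_le_iff_exists.1 hEQ
      have htT : t ∈ T := hE.1 htE
      -- V is the centre of Q. Since (E ⊓ Q)V is abelian, maximality of E bounds its order by 2|E ⊓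
      -- Q|; so the elements of V commuting with t have index at most two in V.
      set V := Q ⊓ Subgroup.centralizer Q with hVdef
      have hVQ : ∀ v ∈ V, ∀ g ∈ Q, Commute v g := fun v hv g hg =>
        ((Subgroup.mem_centralizer_iff.1 hv.2) g hg).symm
      have hcomm : ∀ a ∈ (E ⊓ Q) ⊔ V, ∀ b ∈ (E ⊓ Q) ⊔ V, Commute a b := by
        have h1 : (E ⊓ Q) ⊔ V ≤ Subgroup.centralizer ((E ⊓ Q : Subgroup A) : Set A) := by
          refine sup_le ?_ ?_
          · intro a ha
            exact Subgroup.mem_centralizer_iff.2 fun b hb => hE.2.1 b hb.1 a ha.1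
          · intro a ha
            exact Subgroup.mem_centralizer_iff.2 fun b hb => (hVQ a ha b hb.2).symm
        have h2 : (E ⊓ Q) ⊔ V ≤ Subgroup.centralizer (V : Set A) := by
          have : (E ⊓ Q) ⊔ V ≤ Q := sup_le inf_le_right inf_le_left
          intro a ha
          exact Subgroup.mem_centralizer_iff.2 fun b hb => hVQ b hb a (this ha)
        intro a ha
        have h3 : (E ⊓ Q) ⊔ V ≤ Subgroup.centralizer {a} := by
          refine sup_le ?_ ?_
          · intro b hb
            rw [Subgroup.mem_centralizer_singleton_iff]
            exact (Subgroup.mem_centralizer_iff.1 (h1 ha)) b hb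
          · intro b hb
            rw [Subgroup.mem_centralizer_singleton_iff]
            exact (Subgroup.mem_centralizer_iff.1 (h2 ha)) b hb
        intro b hb
        exact (Subgroup.mem_centralizer_singleton_iff.1 (h3 hb)).symm
      have hcardE : Nat.card ((E ⊓ Q) ⊔ V : Subgroup A) ≤ 2 * Nat.card (E ⊓ Q : Subgroup A) := by
        refine (hE.2.2 _ (sup_le (inf_le_left.trans hE.1) (inf_le_left.trans hQT)) hcomm).trans ?_
        exact Subgroup.card_le_two_mul_card_inf hE.1 hindex
      have hXV : ∀ v ∈ V, X * v * X⁻¹ ∈ V := by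
        intro v hv
        refine ⟨hXQ v hv.1, Subgroup.mem_centralizer_iff.2 fun g hg => ?_⟩
        have h := (hVQ v hv _ (hXQ' g hg)).symm.eq
        have h' := congrArg (fun a => X * a * X⁻¹) h
        simpa [mul_assoc] using h'
      have hVX := commute_of_index_two (hQ.to_le (inf_le_left : V ≤ Q)) hp h5 hX hXQ hXV hVQ
        (hinv t htT htQ) (by
          intro v hv w hw hvt hwt
          refine hE.2.1 _ (Subgroup.inv_mul_mem_of_card_le_two_mul (le_sup_left) hcardE
            ((le_sup_right : V ≤ (E ⊓ Q) ⊔ V) hv) ((le_sup_right : V ≤ (E ⊓ Q) ⊔ V) hw) ?_ ?_).1 t htE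
          · exact fun h => hvt (hE.2.1 _ h.1 t htE)
          · exact fun h => hwt (hE.2.1 _ h.1 t htE))
      -- X now centralizes V, which contains the centre of T. That centre is therefore normalized by
      -- X and Y, hence trivial, which a nontrivial 2-group does not allow.
      have hZV : T ⊓ Subgroup.centralizer T ≤ V := by
        intro z hz
        exact ⟨hZ hz, Subgroup.mem_centralizer_iff.2 fun g hg =>
          (Subgroup.mem_centralizer_iff.1 hz.2) g (hQT hg)⟩
      have hYT' := inv_conj_mem_of_pow_eq_one (p := 2) (by norm_num) (by rw [pow_two, hY]) hYT
      have hbot := hcore (T ⊓ Subgroup.centralizer T) inf_le_left (by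
          intro z hz
          rwa [← (hVX z (hZV hz)).eq, mul_inv_cancel_right]) (by
          intro z hz
          refine ⟨hYT z hz.1, Subgroup.mem_centralizer_iff.2 fun g hg => ?_⟩
          have h := (Subgroup.mem_centralizer_iff.1 hz.2) _ (hYT' g hg)
          have h' := congrArg (fun a => Y * a * Y⁻¹) h
          simpa [mul_assoc] using h')
      by_contra hne
      have : Nontrivial T := (Subgroup.nontrivial_iff_ne_bot T).2 hne
      have hc := hT.center_nontrivial
      obtain ⟨⟨z, hz⟩, hz1⟩ := exists_ne (1 : Subgroup.center T)
      have : (z : A) ∈ T ⊓ Subgroup.centralizer T := by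
        refine ⟨z.2, Subgroup.mem_centralizer_iff.2 fun g hg => ?_⟩
        have := Subgroup.mem_center_iff.1 hz ⟨g, hg⟩
        exact congrArg Subtype.val this
      rw [hbot, Subgroup.mem_bot] at this
      exact hz1 (Subtype.ext (Subtype.ext this))
  · -- a central element of `T` outside `Q` inverts `X`
    obtain ⟨t, ht, htQ⟩ := SetLike.not_le_iff_exists.1 hZ
    have hXc := commute_of_inverting_of_centralizing hQ hp2 hX hXQ hXQ' (hinv t ht.1 htQ)
      (fun g hg => ((Subgroup.mem_centralizer_iff.1 ht.2) g (hQT hg)).symm)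
    set Q' := Q.map (MulAut.conj Y).toMonoidHom with hQ'
    have hmemQ' : ∀ g, g ∈ Q' ↔ Y * g * Y ∈ Q := by
      intro g
      constructor
      · rintro ⟨a, ha, rfl⟩
        have : Y * (Y * a * Y⁻¹) * Y = (Y * Y) * a := by group
        simpa [this, hY] using ha
      · intro h
        refine ⟨_, h, ?_⟩
        simp only [MulEquiv.coe_toMonoidHom, MulAut.conj_apply, hYinv]
        have : Y * (Y * g * Y) * Y = (Y * Y) * g * (Y * Y) := by group
        rw [this, hY, one_mul, mul_one]
    have hQ'T : Q' ≤ T := by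
      rintro _ ⟨a, ha, rfl⟩
      exact hYT a (hQT ha)
    -- X centralizes Q, and Y interchanges Q and Q'. Two subgroups of index at most 2 with trivial
    -- intersection leave |T| ≤ 4.
    have hbot := hcore (Q ⊓ Q') (inf_le_left.trans hQT) (by
        intro g hg
        rwa [(hXc g hg.1).eq, mul_inv_cancel_right]) (by
        intro g hg
        refine ⟨?_, ?_⟩
        · rw [hYinv]; exact (hmemQ' g).1 hg.2
        · refine (hmemQ' _).2 ?_
          have : Y * (Y * g * Y⁻¹) * Y = (Y * Y) * g := by group
          rw [this, hY, one_mul]; exact hg.1)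
    have hcardQ' : Nat.card Q' = Nat.card Q :=
      Subgroup.card_map_of_injective (MulAut.conj Y).injective
    have hr : ∀ P ≤ T, Nat.card T ≤ 2 * Nat.card P → P.relIndex T ≤ 2 := by
      intro P hP hc
      have := Subgroup.card_mul_index (P.subgroupOf T)
      rw [Nat.card_congr (Subgroup.subgroupOfEquivOfLe hP).toEquiv] at this
      rw [← this, mul_comm] at hc
      exact Nat.le_of_mul_le_mul_right hc Nat.card_pos
    have h1 := hr Q hQT hcardT
    have h2 := hr Q' hQ'T (by rw [hcardQ']; exact hcardT)
    have h3 := Subgroup.relIndex_inf_le (H := Q) (K := Q') (L := T)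
    rw [hbot, Subgroup.relIndex_bot_left] at h3
    calc Nat.card T ≤ Q.relIndex T * Q'.relIndex T := h3
      _ ≤ 2 * 2 := Nat.mul_le_mul h1 h2
      _ = 4 := rfl

end Amalgam

/-! ### Triangle counts and edge labels in Cayley graphs -/

section CayleyGraph

variable {G : Type*} [Group G]

/-- A property of group elements that holds for `1` and is inherited by left multiples with two
generators holds everywhere in a finite group. -/
theorem forall_of_mul_left [Finite G] {x y : G} (hgen : Subgroup.closure {x, y} = ⊤) {P : G → Prop}
    (h1 : P 1) (hx : ∀ g, P g → P (x * g)) (hy : ∀ g, P g → P (y * g)) (g : G) : P g := by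
  have hg : g ∈ Submonoid.closure ({x, y} : Set G) := by
    rw [← Subgroup.closure_toSubmonoid_of_finite, hgen]
    trivial
  induction hg using Submonoid.closure_induction_left with
  | one => exact h1
  | mul_left a ha b hb ih =>
    rcases ha with rfl | ha
    · exact hx _ ih
    · rw [Set.mem_singleton_iff.1 ha]; exact hy _ ih

theorem forall_of_mul_right [Finite G] {x y : G} (hgen : Subgroup.closure {x, y} = ⊤) {P : G → Prop}
    (h1 : P 1) (hx : ∀ g, P g → P (g * x)) (hy : ∀ g, P g → P (g * y)) (g : G) : P g := by
  have hg : g ∈ Submonoid.closure ({x, y} : Set G) := by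
    rw [← Subgroup.closure_toSubmonoid_of_finite, hgen]
    trivial
  induction hg using Submonoid.closure_induction_right with
  | one => exact h1
  | mul_right b hb a ha ih =>
    rcases ha with rfl | ha
    · exact hx _ ih
    · rw [Set.mem_singleton_iff.1 ha]; exact hy _ ih

/-- A permutation fixing `1` that is multiplicative on left multiples with generators is an
automorphism. -/
theorem exists_mulEquiv_of_map_mul_generators [Finite G] {x y : G}
    (hgen : Subgroup.closure {x, y} = ⊤) (σ : G ≃ G) (h1 : σ 1 = 1)
    (hx : ∀ g, σ (x * g) = σ x * σ g) (hy : ∀ g, σ (y * g) = σ y * σ g) :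
    ∃ φ : G ≃* G, ∀ g, φ g = σ g := by
  have hmul : ∀ g h, σ (g * h) = σ g * σ h := by
    intro g
    refine forall_of_mul_left hgen (P := fun g => ∀ h, σ (g * h) = σ g * σ h) ?_ ?_ ?_ g
    · intro h; rw [one_mul, h1, one_mul]
    · intro g hg h; rw [mul_assoc, hx, hx, hg, mul_assoc]
    · intro g hg h; rw [mul_assoc, hy, hy, hg, mul_assoc]
  exact ⟨MulEquiv.mk' σ hmul, fun g => rfl⟩

/-- The number of common neighbours of the two ends of an edge labelled `s` in the Cayley graph. -/
noncomputable def commonNeighborNumber (S : Set G) (s : G) : ℕ :=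
  {a : G | a ∈ S ∧ a * s⁻¹ ∈ S}.ncard

/-- Right multiplication by the inverse of `g`, as an automorphism of a Cayley graph. -/
def mulRightIso (S : Set G) : G →* (cayleyGraph S ≃g cayleyGraph S) where
  toFun g :=
    { toEquiv := Equiv.mulRight g⁻¹
      map_rel_iff' := by
        intro a b
        simp [cayleyGraph, SimpleGraph.fromRel_adj] }
  map_one' := by ext; simp
  map_mul' a b := by ext h; simp [mul_assoc]

@[simp]
theorem mulRightIso_apply (S : Set G) (g h : G) : mulRightIso S g h = h * g⁻¹ := rfl

@[simp]
theorem mulRightIso_inv_apply (S : Set G) (g h : G) : (mulRightIso S g)⁻¹ h = h * g := by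
  rw [← map_inv, mulRightIso_apply, inv_inv]

variable {S : Set G}

/-- A Cayley graph in which only the identity fixes the vertex `1` is a graphical regular
representation. -/
theorem isGRR_of_fix_one (h : ∀ σ : cayleyGraph S ≃g cayleyGraph S, σ 1 = 1 → ∀ g, σ g = g) :
    IsGRR (cayleyGraph S) G := by
  have huniq : ∀ (σ τ : cayleyGraph S ≃g cayleyGraph S) (u : G), σ u = τ u → σ = τ := by
    intro σ τ u hu
    have := h (mulRightIso S u * τ⁻¹ * σ * mulRightIso S u⁻¹) (by
      simp [RelIso.mul_apply, hu, RelIso.inv_apply_self])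
    ext g
    have h2 := this (g * u⁻¹)
    simp only [RelIso.mul_apply, mulRightIso_apply, map_inv, mulRightIso_inv_apply,
      inv_mul_cancel_right, mul_left_inj] at h2
    calc σ g = τ (τ⁻¹ (σ g)) := (RelIso.apply_inv_self τ _).symm
      _ = τ g := by rw [h2]
  refine ⟨fun u v => ⟨mulRightIso S (v⁻¹ * u), by simp, fun σ hσ => ?_⟩, ⟨?_⟩⟩
  · exact huniq _ _ u (by simpa using hσ)
  · refine (MulEquiv.ofBijective (mulRightIso S) ⟨?_, ?_⟩).symm
    · intro a b hab
      have := congrArg (fun σ : cayleyGraph S ≃g cayleyGraph S => σ 1) hab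
      simpa using this
    · intro σ
      exact ⟨(σ 1)⁻¹, huniq _ _ 1 (by simp)⟩

/-- An automorphism carries the common neighbours of g and s * g bijectively onto those of the image
edge, so labels can only change within a class of equal triangle count. -/
theorem exists_label (hinv : ∀ s ∈ S, s⁻¹ ∈ S) (hone : (1 : G) ∉ S)
    (σ : cayleyGraph S ≃g cayleyGraph S) {s : G} (hs : s ∈ S) (g : G) :
    ∃ t ∈ S, σ (s * g) = t * σ g ∧ commonNeighborNumber S t = commonNeighborNumber S s := by
  have hadj : ∀ a b : G, b * a⁻¹ ∈ S ↔ σ b * (σ a)⁻¹ ∈ S := by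
    intro a b
    rw [← cayleyGraph_adj_iff S hinv hone, ← cayleyGraph_adj_iff S hinv hone, σ.map_adj_iff]
  refine ⟨σ (s * g) * (σ g)⁻¹, (hadj _ _).1 (by simpa using hs), by simp, ?_⟩
  symm
  refine Set.ncard_congr (fun a _ => σ (a * g) * (σ g)⁻¹) ?_ ?_ ?_
  · rintro a ⟨ha, hb⟩
    refine ⟨(hadj _ _).1 (by simpa using ha), ?_⟩
    have := (hadj (s * g) (a * g)).1 (by simpa [mul_assoc] using hb)
    simpa [mul_assoc] using this
  · intro a b _ _ hab
    simpa using hab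
  · rintro b ⟨hb1, hb2⟩
    refine ⟨σ.symm (b * σ g) * g⁻¹, ⟨?_, ?_⟩, by simp⟩
    · rw [hadj]
      simpa using hb1
    · have := (hadj (s * g) (σ.symm (b * σ g))).2 (by simpa [mul_assoc] using hb2)
      simpa [mul_assoc] using this

theorem commonNeighborNumber_inv (s : G) :
    commonNeighborNumber S s⁻¹ = commonNeighborNumber S s := by
  refine Set.ncard_congr (fun a _ => a * s) ?_ ?_ ?_
  · rintro a ⟨ha, hb⟩
    exact ⟨by simpa using hb, by simpa using ha⟩
  · intro a b _ _ hab
    simpa using hab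
  · rintro b ⟨hb1, hb2⟩
    exact ⟨b * s⁻¹, ⟨hb2, by simpa using hb1⟩, by simp⟩

/-- The set `S` consists of the powers `x ^ i` with `0 < |i| ≤ m` and of the elements of `D`. -/
def IsPowersUnion (S D : Set G) (x : G) (m : ℕ) : Prop :=
  ∀ a, a ∈ S ↔ (∃ i : ℤ, i ≠ 0 ∧ -m ≤ i ∧ i ≤ m ∧ a = x ^ i) ∨ a ∈ D

/-- The elements of `D` are involutions lying outside the powers of `x`, and they are in sufficiently
general position with respect to `x`. -/
structure InGeneralPosition (D : Set G) (x : G) : Prop where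
  mul_self : ∀ d ∈ D, d * d = 1
  ne_zpow : ∀ d ∈ D, ∀ i : ℤ, d ≠ x ^ i
  mul_zpow_eq : ∀ d ∈ D, ∀ d' ∈ D, ∀ i : ℤ, d * x ^ i = d' → x ^ i = 1
  mul_ne_zpow : ∀ d ∈ D, ∀ d' ∈ D, ∀ i : ℤ, d * d' = x ^ i → x ^ i = 1
  mul_ne : ∀ d ∈ D, ∀ d' ∈ D, ∀ d'' ∈ D, d * d' ≠ d''

variable {D : Set G} {x : G} {m : ℕ}

theorem zpow_inj_of_abs_lt (a b : ℤ) (h : x ^ a = x ^ b) (h1 : a - b < orderOf x)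
    (h2 : b - a < orderOf x) : a = b := by
  have h3 : x ^ (a - b) = 1 := by rw [zpow_sub, h, mul_inv_cancel]
  rw [← orderOf_dvd_iff_zpow_eq_one] at h3
  obtain ⟨c, hc⟩ := h3
  have hc1 : c < 1 := by
    by_contra hcc
    nlinarith
  have hc2 : -1 < c := by
    by_contra hcc
    nlinarith
  have : c = 0 := by omega
  rw [this] at hc
  linarith

/-- Only powers of x contribute: exponents i in [j - m, m] other than 0 and j. The bound 3m < |x|
excludes wrap-around, since |i - j - l| ≤ 3m for exponents i, j, l of size at most m. -/
theorem commonNeighborNumber_pow (hS : IsPowersUnion S D x m) (hD : InGeneralPosition D x)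
    (hm : 3 * m < orderOf x) {j : ℕ} (h1 : 1 ≤ j) (hj : j ≤ m) :
    commonNeighborNumber S (x ^ j) = 2 * m - 1 - j := by
  have hset : {a : G | a ∈ S ∧ a * (x ^ j)⁻¹ ∈ S}
      = (fun i : ℤ => x ^ i) ''
        (((Finset.Icc ((j : ℤ) - m) m).erase 0).erase (j : ℤ) : Finset ℤ) := by
    ext a
    simp only [Set.mem_ofPred_eq, Set.mem_image, Finset.mem_coe, Finset.mem_erase, Finset.mem_Icc]
    have hxj : (x ^ j)⁻¹ = x ^ (-(j : ℤ)) := by rw [zpow_neg, zpow_natCast]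
    have hxj1 : x ^ (-(j : ℤ)) ≠ 1 := by
      intro h
      have := zpow_inj_of_abs_lt (x := x) (-(j : ℤ)) 0 (by rw [h, zpow_zero]) (by omega) (by omega)
      omega
    rw [hxj]
    constructor
    · rintro ⟨ha, hb⟩
      rcases (hS a).1 ha with ⟨i, hi0, hi1, hi2, rfl⟩ | ha
      · rcases (hS _).1 hb with ⟨l, hl0, hl1, hl2, hl⟩ | hb
        · have : i - j = l := by
            rw [← zpow_add] at hl
            exact zpow_inj_of_abs_lt _ _ hl (by omega) (by omega)
          exact ⟨i, ⟨by omega, hi0, by omega, by omega⟩, rfl⟩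
        · exact absurd (zpow_add x _ _) (hD.ne_zpow _ hb _ |>.symm)
      · rcases (hS _).1 hb with ⟨l, hl0, hl1, hl2, hl⟩ | hb
        · refine absurd ?_ (hD.ne_zpow a ha (l + j))
          rw [zpow_add, ← hl, mul_assoc, ← zpow_add]
          simp
        · exact absurd (hD.mul_zpow_eq a ha _ hb _ rfl) hxj1
    · rintro ⟨i, ⟨hij, hi0, hi1, hi2⟩, rfl⟩
      refine ⟨(hS _).2 (Or.inl ⟨i, hi0, by omega, by omega, rfl⟩), (hS _).2 (Or.inl
        ⟨i - j, by omega, by omega, by omega, ?_⟩)⟩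
      rw [← zpow_add, sub_eq_add_neg]
  rw [commonNeighborNumber, hset, Set.InjOn.ncard_image, Set.ncard_coe_finset,
    Finset.card_erase_of_mem, Finset.card_erase_of_mem, Int.card_Icc]
  · omega
  · simp; omega
  · simp; omega
  · intro a ha b hb hab
    simp only [Finset.mem_coe, Finset.mem_erase, Finset.mem_Icc] at ha hb
    exact zpow_inj_of_abs_lt a b hab (by omega) (by omega)

/-- A triangle through such an edge would be a product relation of length three, and general
position forbids every mixture of powers of x and elements of D. -/
theorem commonNeighborNumber_of_mem (hS : IsPowersUnion S D x m) (hD : InGeneralPosition D x)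
    (hm : 3 * m < orderOf x) {d : G} (hd : d ∈ D) : commonNeighborNumber S d = 0 := by
  have hdinv : d⁻¹ = d := inv_eq_of_mul_eq_one_left (hD.mul_self d hd)
  have hne : ∀ i : ℤ, i ≠ 0 → -m ≤ i → i ≤ m → x ^ i ≠ 1 := by
    intro i hi0 hi1 hi2 h
    exact hi0 (zpow_inj_of_abs_lt i 0 (by rw [h, zpow_zero]) (by omega) (by omega))
  have hset : {a : G | a ∈ S ∧ a * d⁻¹ ∈ S} = ∅ := by
    rw [Set.eq_empty_iff_forall_notMem]
    rintro a ⟨ha, hb⟩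
    rw [hdinv] at hb
    rcases (hS a).1 ha with ⟨i, hi0, hi1, hi2, rfl⟩ | ha
    · rcases (hS _).1 hb with ⟨l, hl0, hl1, hl2, hl⟩ | hb
      · refine hD.ne_zpow d hd (-i + l) ?_
        rw [zpow_add, ← hl, ← mul_assoc, ← zpow_add]
        simp
      · refine hne i hi0 hi1 hi2 (hD.mul_ne_zpow _ hb d hd i ?_)
        rw [mul_assoc, hD.mul_self d hd, mul_one]
    · rcases (hS _).1 hb with ⟨l, hl0, hl1, hl2, hl⟩ | hb
      · exact hne l hl0 hl1 hl2 (hD.mul_ne_zpow a ha d hd l hl)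
      · exact hD.mul_ne a ha d hd _ hb rfl
  rw [commonNeighborNumber, hset, Set.ncard_empty]

theorem commonNeighborNumber_zpow (hS : IsPowersUnion S D x m) (hD : InGeneralPosition D x)
    (hm : 3 * m < orderOf x) {i : ℤ} (h0 : i ≠ 0) (h1 : -m ≤ i) (h2 : i ≤ m) :
    commonNeighborNumber S (x ^ i) = 2 * m - 1 - i.natAbs := by
  obtain ⟨j, rfl | rfl⟩ := i.eq_nat_or_neg
  · rw [zpow_natCast, commonNeighborNumber_pow hS hD hm (by omega) (by omega)]
    simp
  · rw [zpow_neg, zpow_natCast, commonNeighborNumber_inv,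
      commonNeighborNumber_pow hS hD hm (by omega) (by omega)]
    simp

/-- Automorphisms of the Cayley graph preserve the edges labelled by `x`. -/
theorem map_mul_eq_or (hinv : ∀ s ∈ S, s⁻¹ ∈ S) (hone : (1 : G) ∉ S)
    (hS : IsPowersUnion S D x m) (hD : InGeneralPosition D x) (hm : 3 * m < orderOf x)
    (hm2 : 2 ≤ m) (σ : cayleyGraph S ≃g cayleyGraph S) (g : G) :
    σ (x * g) = x * σ g ∨ σ (x * g) = x⁻¹ * σ g := by
  have hx : x = x ^ (1 : ℤ) := (zpow_one x).symm
  have hxS : x ∈ S := (hS x).2 (Or.inl ⟨1, by omega, by omega, by omega, hx⟩)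
  obtain ⟨t, ht, hσ, hcn⟩ := exists_label hinv hone σ hxS g
  have hcx : commonNeighborNumber S x = 2 * m - 2 := by
    have := commonNeighborNumber_zpow hS hD hm (i := 1) (by omega) (by omega) (by omega)
    rw [← hx] at this
    rw [this]; simp; omega
  rw [hcx] at hcn
  rcases (hS t).1 ht with ⟨i, hi0, hi1, hi2, rfl⟩ | ht
  · rw [commonNeighborNumber_zpow hS hD hm hi0 hi1 hi2] at hcn
    -- The count 2m - 1 - |i| strictly decreases in |i| ≤ m, so only ±1 attain 2m - 2.
    have : i = 1 ∨ i = -1 := by omega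
    rcases this with rfl | rfl
    · left; simpa using hσ
    · right; simpa using hσ
  · rw [commonNeighborNumber_of_mem hS hD hm ht] at hcn
    omega

/-- Automorphisms of the Cayley graph preserve the set of edges labelled by elements of `D`. -/
theorem exists_map_mul_eq (hinv : ∀ s ∈ S, s⁻¹ ∈ S) (hone : (1 : G) ∉ S)
    (hS : IsPowersUnion S D x m) (hD : InGeneralPosition D x) (hm : 3 * m < orderOf x)
    (hm2 : 2 ≤ m) (σ : cayleyGraph S ≃g cayleyGraph S) {d : G} (hd : d ∈ D) (g : G) :
    ∃ d' ∈ D, σ (d * g) = d' * σ g := by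
  obtain ⟨t, ht, hσ, hcn⟩ := exists_label hinv hone σ ((hS d).2 (Or.inr hd)) g
  rw [commonNeighborNumber_of_mem hS hD hm hd] at hcn
  rcases (hS t).1 ht with ⟨i, hi0, hi1, hi2, rfl⟩ | ht
  -- For powers of x the count is at least m - 1 > 0.
  · rw [commonNeighborNumber_zpow hS hD hm hi0 hi1 hi2] at hcn
    omega
  · exact ⟨t, ht, hσ⟩

/-- Along a coset of the powers of `x`, an automorphism preserves or reverses the direction. -/
theorem map_inv_mul_of_map_mul_eq_or {σ : G ≃ G}
    (h : ∀ g, σ (x * g) = x * σ g ∨ σ (x * g) = x⁻¹ * σ g)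
    (hx : x * x ≠ 1) (g : G) :
    (σ (x * g) = x * σ g → σ (x⁻¹ * g) = x⁻¹ * σ g) ∧
    (σ (x * g) = x⁻¹ * σ g → σ (x⁻¹ * g) = x * σ g) := by
  have hne : σ (x⁻¹ * g) ≠ σ (x * g) := by
    intro h
    have := σ.injective h
    apply hx
    rw [mul_left_inj] at this
    nth_rw 1 [← this]
    simp
  rcases h (x⁻¹ * g) with h' | h' <;> rw [mul_inv_cancel_left] at h'
  · have h2 : σ (x⁻¹ * g) = x⁻¹ * σ g := by rw [h', inv_mul_cancel_left]
    exact ⟨fun _ => h2, fun h3 => absurd (h2.trans h3.symm) hne⟩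
  · have h2 : σ (x⁻¹ * g) = x * σ g := by rw [h', mul_inv_cancel_left]
    exact ⟨fun h3 => absurd (h2.trans h3.symm) hne, fun _ => h2⟩

end CayleyGraph

/-! ### Generation by x and an involution; the quadrangle argument -/

section TwoGenerators

variable {G : Type*} [Group G]

/-- A nontrivial mixed relation between y, x⁻¹yx and powers of x rearranges to y xⁱ = xʲ y, which
`hN` restricts to xⁱ = 1. -/
theorem inGeneralPosition_pair {x y : G} (hx : x ≠ 1) (hyy : y * y = 1)
    (hy : ∀ i : ℤ, y ≠ x ^ i) (hN : ∀ i j : ℤ, y * x ^ i = x ^ j * y → x ^ i = 1) :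
    InGeneralPosition {y, x⁻¹ * y * x} x := by
  have hy1 : y ≠ 1 := by simpa using hy 0
  have hyinv : y⁻¹ = y := inv_eq_of_mul_eq_one_left hyy
  have hzz : (x⁻¹ * y * x) * (x⁻¹ * y * x) = 1 := by
    have : (x⁻¹ * y * x) * (x⁻¹ * y * x) = x⁻¹ * (y * y) * x := by group
    rw [this, hyy]; group
  have hz1 : x⁻¹ * y * x ≠ 1 := by
    intro h
    rw [h] at hzz
    apply hy1
    have : y = x * (x⁻¹ * y * x) * x⁻¹ := by group
    rw [this, h]; group
  have hxm : x ^ (-1 : ℤ) ≠ 1 := by simpa using hx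
  have hxp : x ^ (1 : ℤ) ≠ 1 := by simpa using hx
  refine ⟨?_, ?_, ?_, ?_, ?_⟩
  · rintro d (rfl | rfl)
    · exact hyy
    · exact hzz
  · rintro d (rfl | rfl) i h
    · exact hy i h
    · apply hy i
      have : y = x * (x⁻¹ * y * x) * x⁻¹ := by group
      rw [this, h]; group
  · rintro d (rfl | rfl) d' (rfl | rfl) i h
    · simpa using h
    · exfalso
      have h1 : d * x ^ (i - 1) = x ^ (-1 : ℤ) * d := by
        rw [zpow_sub_one, ← mul_assoc, h]; group
      have h2 := hN _ _ h1
      rw [h2, mul_one] at h1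
      exact hxm (by simpa using h1)
    · exfalso
      have h1 : d' * x ^ (i + 1) = x ^ (1 : ℤ) * d' := by
        nth_rw 2 [← h]; group
      have h2 := hN _ _ h1
      rw [h2, mul_one] at h1
      exact hxp (by simpa using h1)
    · simpa using h
  · rintro d (rfl | rfl) d' (rfl | rfl) i h
    · rw [← h, hyy]
    · exfalso
      refine hxm (hN (-1) (i - 1) ?_)
      have : d * x ^ (-1 : ℤ) = (d * (x⁻¹ * d * x)) * x⁻¹ * d⁻¹ := by group
      rw [this, h, hyinv]; group
    · exfalso
      refine hxp (hN 1 (i + 1) ?_)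
      have : d' * x ^ (1 : ℤ) = x * (x⁻¹ * d' * x * d') * d'⁻¹ := by group
      rw [this, h, hyinv]; group
    · rw [← h, hzz]
  · rintro d (rfl | rfl) d' (rfl | rfl) d'' (rfl | rfl) h
    · exact hy1 (by simpa using h)
    · rw [hyy] at h; exact hz1 h.symm
    · exact hz1 (by simpa using h)
    · exact hy1 (by simpa using h)
    · exact hz1 (by simpa using h)
    · exact hy1 (by simpa using h)
    · rw [hzz] at h; exact hy1 h.symm
    · exact hz1 (by simpa using h)

theorem InGeneralPosition.mono {D D' : Set G} {x : G} (h : InGeneralPosition D x) (hD : D' ⊆ D) :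
    InGeneralPosition D' x where
  mul_self d hd := h.mul_self d (hD hd)
  ne_zpow d hd := h.ne_zpow d (hD hd)
  mul_zpow_eq d hd d' hd' := h.mul_zpow_eq d (hD hd) d' (hD hd')
  mul_ne_zpow d hd d' hd' := h.mul_ne_zpow d (hD hd) d' (hD hd')
  mul_ne d hd d' hd' d'' hd'' := h.mul_ne d (hD hd) d' (hD hd') d'' (hD hd'')

/-- In a simple group generated by an element `x` of odd prime order and an involution `y`, the
involution does not normalize the powers of `x`. -/
theorem zpow_eq_one_of_conj [IsSimpleGroup G] [Finite G] {x y : G} {p : ℕ}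
    (hp : p.Prime) (hp2 : p ≠ 2)
    (hgen : Subgroup.closure {x, y} = ⊤) (hx : orderOf x = p) (hy : orderOf y = 2) (i j : ℤ)
    (h : y * x ^ i = x ^ j * y) : x ^ i = 1 := by
  by_contra hne
  have hyy : y * y = 1 := by rw [← pow_two, ← hy, pow_orderOf_eq_one]
  have hyinv : y⁻¹ = y := inv_eq_of_mul_eq_one_left hyy
  have hndvd : ¬ (p : ℤ) ∣ i := by rwa [← hx, orderOf_dvd_iff_zpow_eq_one]
  obtain ⟨u, v, huv⟩ : IsCoprime (p : ℤ) i :=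
    (Nat.prime_iff_prime_int.1 hp).coprime_iff_not_dvd.2 hndvd
  have hxp : x ^ (p : ℤ) = 1 := by rw [zpow_natCast, ← hx, pow_orderOf_eq_one]
  have hxi : x = (x ^ i) ^ v := by
    rw [← zpow_mul]
    nth_rw 1 [← zpow_one x, ← huv]
    rw [zpow_add, mul_comm u, zpow_mul, hxp, one_zpow, one_mul, mul_comm]
  have hconj : y * x * y⁻¹ = x ^ (j * v) := by
    have h1 : y * x ^ i * y⁻¹ = x ^ j := by rw [h, mul_inv_cancel_right]
    conv_lhs => rw [hxi]
    rw [← conj_zpow, h1, zpow_mul]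
  -- As i is invertible modulo p, y conjugates x to a power of x. Simplicity then makes x generate
  -- G, leaving no room for an involution.
  have hnormal : (Subgroup.zpowers x).Normal := by
    rw [← Subgroup.normalizer_eq_top_iff, eq_top_iff, ← hgen, Subgroup.closure_le]
    rintro g (rfl | hg)
    · exact Subgroup.le_normalizer (Subgroup.mem_zpowers g)
    · rw [Set.mem_singleton_iff] at hg
      subst hg
      have key : ∀ a ∈ Subgroup.zpowers x, g * a * g⁻¹ ∈ Subgroup.zpowers x := by
        rintro _ ⟨l, rfl⟩
        exact ⟨j * v * l, by simp only; rw [← conj_zpow, hconj, ← zpow_mul]⟩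
      rw [SetLike.mem_coe, Subgroup.mem_normalizer_iff]
      intro a
      refine ⟨key a, fun ha => ?_⟩
      have := key _ ha
      rw [hyinv] at this
      have e : g * (g * a * g) * g = (g * g) * a * (g * g) := by group
      rwa [e, hyy, one_mul, mul_one] at this
  have htop : Subgroup.zpowers x = ⊤ := by
    refine hnormal.eq_bot_or_eq_top.resolve_left fun hb => ?_
    rw [Subgroup.zpowers_eq_bot] at hb
    exact hne (by rw [hb, one_zpow])
  have hmem : y ∈ Subgroup.zpowers x := by rw [htop]; trivial
  have hdvd := orderOf_dvd_of_mem_zpowers hmem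
  rw [hx, hy, Nat.prime_dvd_prime_iff_eq Nat.prime_two hp] at hdvd
  exact hp2 hdvd.symm

/-- For a permutation preserving the edges labelled by `x`, and preserving the set of edges labelled
by `y` and by `x⁻¹ * y * x`, the quadrangles formed by such edges force the direction of the edges
labelled by `x` to be the same at `c` and at `y * c`. -/
theorem sign_eq_of_quadrangle {x y : G} (hx : 2 < orderOf x)
    (hN : ∀ i j : ℤ, y * x ^ i = x ^ j * y → x ^ i = 1) {σ : G ≃ G}
    (hσx : ∀ g, σ (x * g) = x * σ g ∨ σ (x * g) = x⁻¹ * σ g)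
    (hσy : ∀ g, σ (y * g) = y * σ g ∨ σ (y * g) = x⁻¹ * y * x * σ g)
    (hσz : ∀ g, σ (x⁻¹ * y * x * g) = y * σ g ∨ σ (x⁻¹ * y * x * g) = x⁻¹ * y * x * σ g) (c : G) :
    (σ (x * c) = x * σ c → σ (y * c) = y * σ c ∧ σ (x * (y * c)) = x * σ (y * c)) ∧
    (σ (x * c) = x⁻¹ * σ c →
      σ (y * c) = x⁻¹ * y * x * σ c ∧ σ (x * (y * c)) = x⁻¹ * σ (y * c)) := by
  have hxx : x * x ≠ 1 := by
    intro h
    have := orderOf_le_of_pow_eq_one (x := x) (n := 2) (by norm_num) (by rw [pow_two, h])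
    omega
  have hsign : ∀ g, ∃ ε : ℤ, (ε = 1 ∨ ε = -1) ∧ σ (x * g) = x ^ ε * σ g ∧
      σ (x⁻¹ * g) = x ^ (-ε) * σ g := by
    intro g
    have h := map_inv_mul_of_map_mul_eq_or hσx hxx g
    rcases hσx g with h' | h'
    · exact ⟨1, Or.inl rfl, by simpa using h', by simpa using h.1 h'⟩
    · exact ⟨-1, Or.inr rfl, by simpa using h', by simpa using h.2 h'⟩
  -- Both involution labels are written as x^(-α) y x^α with α ∈ {0, 1}, so that the quadrangle
  -- becomes an equation in exponents.
  have htype : ∀ (τ : G) (g : G), (τ = y * g ∨ τ = x⁻¹ * y * x * g) →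
      ∃ α : ℤ, (α = 0 ∨ α = 1) ∧ τ = x ^ (-α) * y * x ^ α * g := by
    rintro τ g (h | h)
    · exact ⟨0, Or.inl rfl, by simpa using h⟩
    · exact ⟨1, Or.inr rfl, by simpa using h⟩
  obtain ⟨ε, hε, hε1, hε2⟩ := hsign c
  obtain ⟨ε', hε', hε1', hε2'⟩ := hsign (y * c)
  obtain ⟨α, hα, hα1⟩ := htype _ _ (hσz (x⁻¹ * c))
  obtain ⟨β, hβ, hβ1⟩ := htype _ _ (hσy c)
  -- The quadrangle c, yc, x⁻¹yc, x⁻¹c. Its image yields α - ε - β = 0 = α - ε' - β, hence ε = ε',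
  -- and α, β ∈ {0, 1} leaves one β for each sign.
  have e1 : x⁻¹ * y * x * (x⁻¹ * c) = x⁻¹ * (y * c) := by group
  rw [e1, hε2', hβ1, hε2] at hα1
  have h1 : y * x ^ (α - ε - β) = x ^ (α - ε' - β) * y := by
    have h2 : x ^ (-ε') * (x ^ (-β) * y * x ^ β) = x ^ (-α) * y * x ^ α * x ^ (-ε) := by
      refine mul_right_cancel (b := σ c) ?_
      simpa only [mul_assoc] using hα1
    have h3 : y * x ^ (α - ε - β) = x ^ α * (x ^ (-α) * y * x ^ α * x ^ (-ε)) * x ^ (-β) := by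
      group
    rw [h3, ← h2]
    group
  have h2 := hN _ _ h1
  have h3 : α - ε - β = 0 :=
    zpow_inj_of_abs_lt (x := x) _ 0 (by rw [h2, zpow_zero]) (by omega) (by omega)
  have h4 : α - ε' - β = 0 := by
    rw [h2, mul_one, right_eq_mul] at h1
    exact zpow_inj_of_abs_lt (x := x) _ 0 (by rw [h1, zpow_zero]) (by omega) (by omega)
  have hne : ∀ g, x * g ≠ x⁻¹ * g := by
    intro g h
    rw [mul_left_inj] at h
    exact hxx (by nth_rw 1 [h]; simp)
  have hεε : ε' = ε := by omega
  subst hεε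
  rcases hε with rfl | rfl
  · have : β = 0 := by omega
    subst this
    simp only [zpow_one] at hε1 hε1'
    refine ⟨fun _ => ⟨by simpa using hβ1, hε1'⟩, fun h => ?_⟩
    exact absurd (hε1.symm.trans h) (hne _)
  · have : β = 1 := by omega
    subst this
    simp only [zpow_neg, zpow_one] at hε1 hε1' hβ1
    refine ⟨fun h => ?_, fun _ => ⟨hβ1, hε1'⟩⟩
    exact absurd (h.symm.trans hε1) (hne _)

/-- A permutation fixing `1` which preserves the edges labelled by `x` and the set of edges labelled
by `y` and by `x⁻¹ * y * x` is trivial, unless some automorphism inverts `x` and fixes `y`. -/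
theorem eq_one_of_quadrangle [Finite G] {x y : G} (hgen : Subgroup.closure {x, y} = ⊤)
    (hx : 2 < orderOf x) (hN : ∀ i j : ℤ, y * x ^ i = x ^ j * y → x ^ i = 1)
    (hno : ¬ ∃ φ : G ≃* G, φ x = x⁻¹ ∧ φ y = y) {σ : G ≃ G} (h1 : σ 1 = 1)
    (hσx : ∀ g, σ (x * g) = x * σ g ∨ σ (x * g) = x⁻¹ * σ g)
    (hσy : ∀ g, σ (y * g) = y * σ g ∨ σ (y * g) = x⁻¹ * y * x * σ g)
    (hσz : ∀ g, σ (x⁻¹ * y * x * g) = y * σ g ∨ σ (x⁻¹ * y * x * g) = x⁻¹ * y * x * σ g) (g : G) :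
    σ g = g := by
  have hquad := sign_eq_of_quadrangle hx hN hσx hσy hσz
  have hxx : x * x ≠ 1 := by
    intro h
    have := orderOf_le_of_pow_eq_one (x := x) (n := 2) (by norm_num) (by rw [pow_two, h])
    omega
  rcases hσx 1 with h | h
  · refine (forall_of_mul_left hgen (P := fun g => σ (x * g) = x * σ g ∧ σ g = g) ⟨h, h1⟩
      ?_ ?_ g).2
    · rintro g ⟨hg, hg'⟩
      refine ⟨?_, by rw [hg, hg']⟩
      rcases hσx (x * g) with h' | h'
      · exact h'
      · rw [hg, inv_mul_cancel_left, σ.apply_eq_iff_eq] at h'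
        rw [← mul_assoc, mul_eq_right] at h'
        exact absurd h' hxx
    · rintro g ⟨hg, hg'⟩
      have := (hquad g).1 hg
      exact ⟨this.2, by rw [this.1, hg']⟩
  · exfalso
    have hall : ∀ g, σ (x * g) = x⁻¹ * σ g := by
      refine forall_of_mul_left hgen h ?_ ?_
      · intro g hg
        rcases hσx (x * g) with h' | h'
        · rw [hg, mul_inv_cancel_left, σ.apply_eq_iff_eq] at h'
          rw [← mul_assoc, mul_eq_right] at h'
          exact absurd h' hxx
        · exact h'
      · intro g hg
        exact ((hquad g).2 hg).2
    have hally : ∀ g, σ (y * g) = x⁻¹ * y * x * σ g := fun g => ((hquad g).2 (hall g)).1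
    have hx1 : σ x = x⁻¹ := by simpa [h1] using hall 1
    have hy1 : σ y = x⁻¹ * y * x := by simpa [h1] using hally 1
    obtain ⟨φ, hφ⟩ := exists_mulEquiv_of_map_mul_generators hgen σ h1
      (fun g => by rw [hall, hx1]) (fun g => by rw [hally, hy1])
    -- The automorphism φ sends x to x⁻¹ and y to x⁻¹yx; conjugation by x restores y and leaves x⁻¹
    -- alone.
    refine hno ⟨φ.trans (MulAut.conj x), ?_, ?_⟩
    · simp [hφ, hx1]
    · simp [hφ, hy1, mul_assoc]

end TwoGenerators

/-! ### Vertex stabilizers and the GRR criterion -/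

section Regular

variable {G : Type*} [Group G]

/-- The stabilizer of the vertex `1` in the automorphism group of a Cayley graph. -/
def oneStabilizer (S : Set G) : Subgroup (cayleyGraph S ≃g cayleyGraph S) where
  carrier := {σ | σ 1 = 1}
  one_mem' := rfl
  mul_mem' {a b} ha hb := by
    change a (b 1) = 1
    rw [show b 1 = 1 from hb]; exact ha
  inv_mem' {a} ha := by
    change a⁻¹ 1 = 1
    nth_rw 1 [← show a 1 = 1 from ha]
    exact RelIso.inv_apply_self a 1

/-- The automorphisms fixing the vertices `1` and `x`. -/
def oneStabilizerInf (S : Set G) (x : G) : Subgroup (cayleyGraph S ≃g cayleyGraph S) where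
  carrier := {σ | σ 1 = 1 ∧ σ x = x}
  one_mem' := ⟨rfl, rfl⟩
  mul_mem' {a b} ha hb := by
    refine ⟨?_, ?_⟩
    · change a (b 1) = 1
      rw [hb.1]; exact ha.1
    · change a (b x) = x
      rw [hb.2]; exact ha.2
  inv_mem' {a} ha := by
    refine ⟨?_, ?_⟩
    · nth_rw 1 [← ha.1]
      exact RelIso.inv_apply_self a 1
    · nth_rw 1 [← ha.2]
      exact RelIso.inv_apply_self a x

theorem mem_oneStabilizer {S : Set G} {σ : cayleyGraph S ≃g cayleyGraph S} :
    σ ∈ oneStabilizer S ↔ σ 1 = 1 := Iff.rfl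

variable {S : Set G} {x y : G}

instance finite_cayleyGraph_iso [Finite G] : Finite (cayleyGraph S ≃g cayleyGraph S) :=
  Finite.of_injective (fun σ : cayleyGraph S ≃g cayleyGraph S => σ.toEquiv)
    (fun _ _ h => RelIso.toEquiv_injective h)

/-- The stabilizer of a vertex is a `2`-group when automorphisms preserve the edges labelled by `x`
and those labelled by `y`. -/
theorem isPGroup_oneStabilizer [Finite G] (hgen : Subgroup.closure {x, y} = ⊤)
    (hxx : x * x ≠ 1)
    (hσx : ∀ (σ : cayleyGraph S ≃g cayleyGraph S) g, σ (x * g) = x * σ g ∨ σ (x * g) = x⁻¹ * σ g)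
    (hσy : ∀ (σ : cayleyGraph S ≃g cayleyGraph S) g, σ (y * g) = y * σ g) :
    IsPGroup 2 (oneStabilizer S) := by
  rw [IsPGroup.iff_orderOf]
  rintro ⟨σ, hσ⟩
  obtain ⟨k, l, hl, hkl⟩ := Nat.exists_eq_two_pow_mul_odd (n := orderOf σ) (orderOf_pos σ).ne'
  refine ⟨k, ?_⟩
  set τ := σ ^ 2 ^ k with hτ
  have hτl : τ ^ l = 1 := by rw [hτ, ← pow_mul, ← hkl, pow_orderOf_eq_one]
  have hτ1 : τ 1 = 1 := mem_oneStabilizer.1 ((oneStabilizer S).pow_mem hσ _)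
  have hfix : ∀ g, τ g = g := by
    refine forall_of_mul_left hgen hτ1 ?_ ?_
    · intro g hg
      -- At a fixed vertex g, τ fixes or interchanges xg and x⁻¹g, so τ² fixes both. Having odd
      -- order, τ then fixes xg itself.
      have hsq : (τ ^ 2) (x * g) = x * g := by
        rw [pow_two, RelIso.mul_apply]
        rcases hσx τ g with h | h <;> rw [hg] at h
        · rw [h, h]
        · have := (map_inv_mul_of_map_mul_eq_or (σ := τ.toEquiv) (hσx τ) hxx g).2
            (by simpa [hg] using h)
          rw [h]
          simpa [hg] using this
      obtain ⟨r, hr⟩ := hl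
      have hiter : ∀ s : ℕ, ((τ ^ 2) ^ s) (x * g) = x * g := by
        intro s
        induction s with
        | zero => rfl
        | succ s ih => rw [pow_succ, RelIso.mul_apply, hsq, ih]
      have h1 := congrArg (fun a : cayleyGraph S ≃g cayleyGraph S => a (x * g)) hτl
      rw [hr, pow_succ', pow_mul, RelIso.mul_apply, hiter] at h1
      exact h1
    · intro g hg
      rw [hσy, hg]
  have hτ' : τ = 1 := by
    ext g
    exact hfix g
  have horder : orderOf σ ∣ 2 ^ k := orderOf_dvd_of_pow_eq_one hτ'
  rw [Subgroup.orderOf_mk]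
  rw [hkl] at horder ⊢
  have hl1 : l = 1 := by
    have h1 : l ∣ 1 := by
      have := Nat.le_of_dvd (by positivity) horder
      have h2 : 0 < 2 ^ k := by positivity
      have h3 : l ≤ 1 := by
        by_contra hc
        push Not at hc
        nlinarith
      have h4 : l ≠ 0 := by rintro rfl; exact absurd hl (by decide)
      rw [Nat.dvd_one]; omega
    exact Nat.dvd_one.1 h1
  rw [hl1, mul_one]

theorem map_inv_of_mem {σ : cayleyGraph S ≃g cayleyGraph S} (hxx : x * x ≠ 1)
    (hσx : ∀ (σ : cayleyGraph S ≃g cayleyGraph S) g, σ (x * g) = x * σ g ∨ σ (x * g) = x⁻¹ * σ g)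
    (h1 : σ 1 = 1) : (σ x = x → σ x⁻¹ = x⁻¹) ∧ (σ x = x⁻¹ → σ x⁻¹ = x) := by
  have := map_inv_mul_of_map_mul_eq_or (σ := σ.toEquiv) (hσx σ) hxx 1
  simpa [h1] using this

/-- The stabilizer of a vertex has order at most four. -/
theorem card_oneStabilizer_le [Finite G] {p : ℕ} (hp : p.Prime) (h5 : 5 ≤ p) (hx : orderOf x = p)
    (hyy : y * y = 1) (hgen : Subgroup.closure {x, y} = ⊤)
    (hσx : ∀ (σ : cayleyGraph S ≃g cayleyGraph S) g, σ (x * g) = x * σ g ∨ σ (x * g) = x⁻¹ * σ g)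
    (hσy : ∀ (σ : cayleyGraph S ≃g cayleyGraph S) g, σ (y * g) = y * σ g) :
    Nat.card (oneStabilizer S) ≤ 4 := by
  have hxx : x * x ≠ 1 := by
    intro h
    have := orderOf_le_of_pow_eq_one (x := x) (n := 2) (by norm_num) (by rw [pow_two, h])
    omega
  have hor : ∀ σ : cayleyGraph S ≃g cayleyGraph S, σ 1 = 1 → σ x = x ∨ σ x = x⁻¹ := by
    intro σ h1
    simpa [h1] using hσx σ 1
  have hinv1 : ∀ σ : cayleyGraph S ≃g cayleyGraph S, σ 1 = 1 → σ⁻¹ 1 = 1 := fun σ h =>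
    (oneStabilizer S).inv_mem h
  have hXp : mulRightIso S x⁻¹ ^ p = 1 := by
    rw [← map_pow, inv_pow, ← hx, pow_orderOf_eq_one, inv_one, map_one]
  -- Because of the inverse in `mulRightIso`, X is right multiplication by x itself. It normalizes Q
  -- since an automorphism fixing 1 and x also fixes x⁻¹.
  refine card_le_four_of_amalgam (T := oneStabilizer S) (Q := oneStabilizerInf S x)
    (fun σ hσ => hσ.1) (isPGroup_oneStabilizer hgen hxx hσx hσy) (X := mulRightIso S x⁻¹)
    (Y := mulRightIso S y) hp h5 hXp ?_ ?_ ?_ ?_ ?_ ?_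
  · rw [← map_mul, hyy, map_one]
  · rintro σ ⟨h1, h2⟩
    have := (map_inv_of_mem hxx hσx h1).1 h2
    refine ⟨?_, ?_⟩
    · simp [this]
    · simp [h1]
  · intro σ h1
    have : σ y = y := by simpa [show σ 1 = 1 from h1] using hσy σ 1
    rw [mem_oneStabilizer]
    simp [this]
  · intro s hs t ht hsQ htQ
    have hs1 : s 1 = 1 := hs
    have ht1 : t 1 = 1 := ht
    have hsx := (hor s hs1).resolve_left (fun h => hsQ ⟨hs1, h⟩)
    have htx := (hor t ht1).resolve_left (fun h => htQ ⟨ht1, h⟩)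
    refine ⟨?_, ?_⟩
    · rw [RelIso.mul_apply, ht1, hs1]
    · rw [RelIso.mul_apply, htx, (map_inv_of_mem hxx hσx hs1).2 hsx]
  · intro t ht htQ
    have ht1 : t 1 = 1 := ht
    have htx := (hor t ht1).resolve_left (fun h => htQ ⟨ht1, h⟩)
    have htx' := (map_inv_of_mem hxx hσx ht1).2 htx
    have h1 : t⁻¹ 1 = 1 := hinv1 t ht1
    have h2 : t⁻¹ x = x⁻¹ := by
      nth_rw 1 [← htx']
      exact RelIso.inv_apply_self t _
    refine ⟨?_, ?_⟩
    · simp [h1, htx]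
    · simp [h2, ht1]
  · intro K hK hKX hKY
    -- Being normalized by X and Y, the subgroup K fixes gx and gy whenever it fixes g; start at 1.
    have hfix : ∀ g, ∀ σ ∈ K, σ g = g := by
      refine forall_of_mul_right hgen (fun σ hσ => hK hσ) ?_ ?_
      · intro g hg σ hσ
        have := hg _ (inv_conj_mem_of_pow_eq_one hp.pos hXp hKX σ hσ)
        simp only [RelIso.mul_apply, mulRightIso_apply, mulRightIso_inv_apply, inv_inv] at this
        simpa using congrArg (· * x) this
      · intro g hg σ hσ
        have := hg _ (hKY σ hσ)
        simp only [RelIso.mul_apply, mulRightIso_apply, mulRightIso_inv_apply] at this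
        simpa using congrArg (· * y) this
    rw [eq_bot_iff]
    intro σ hσ
    rw [Subgroup.mem_bot]
    ext g
    exact hfix g σ hσ

/-- If the stabilizer of the vertex `1` has order at most four then the right multiplications form a
normal subgroup. -/
theorem exists_conj_mulRightIso_eq [Finite G] [IsSimpleGroup G] {p : ℕ} (hp : p.Prime) (h5 : 5 ≤ p)
    (hx : orderOf x = p) (hcard : Nat.card (oneStabilizer S) ≤ 4)
    (σ : cayleyGraph S ≃g cayleyGraph S) (g : G) :
    ∃ h, σ * mulRightIso S g * σ⁻¹ = mulRightIso S h := by
  set R := (mulRightIso S).range with hR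
  have hindex : Nat.card ((cayleyGraph S ≃g cayleyGraph S) ⧸ R) ≤ 4 := by
    refine (Nat.card_le_card_of_surjective
      (fun t : oneStabilizer S => ((t : cayleyGraph S ≃g cayleyGraph S) :
        (cayleyGraph S ≃g cayleyGraph S) ⧸ R)) ?_).trans hcard
    intro a
    induction a using QuotientGroup.induction_on with
    | H a =>
      refine ⟨⟨a * mulRightIso S (a⁻¹ 1)⁻¹, ?_⟩, ?_⟩
      · rw [mem_oneStabilizer, RelIso.mul_apply, mulRightIso_apply, inv_inv, one_mul]
        exact RelIso.apply_inv_self a 1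
      · simp only
        rw [QuotientGroup.eq]
        refine ⟨a⁻¹ 1, ?_⟩
        rw [map_inv]; group
  -- The image of x permutes at most 4 cosets, and p ≥ 5 does not divide the order of that symmetric
  -- group.
  have hxcore : mulRightIso S x ∈ R.normalCore := by
    rw [Subgroup.normalCore_eq_ker, MonoidHom.mem_ker]
    set f := MulAction.toPermHom (cayleyGraph S ≃g cayleyGraph S)
      ((cayleyGraph S ≃g cayleyGraph S) ⧸ R) (mulRightIso S x) with hf
    have h1 : orderOf f ∣ p := by
      rw [← hx]
      exact (orderOf_map_dvd _ _).trans (orderOf_map_dvd _ _)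
    rcases (Nat.dvd_prime hp).1 h1 with h | h
    · exact orderOf_eq_one_iff.1 h
    · exfalso
      have h2 : orderOf f ∣ Nat.card (Equiv.Perm ((cayleyGraph S ≃g cayleyGraph S) ⧸ R)) :=
        orderOf_dvd_natCard f
      rw [Nat.card_perm, h, hp.dvd_factorial] at h2
      omega
  have hnormal : (R.normalCore.comap (mulRightIso S)).Normal := inferInstance
  have htop : R.normalCore.comap (mulRightIso S) = ⊤ := by
    refine hnormal.eq_bot_or_eq_top.resolve_left fun hb => ?_
    have h1 : x ∈ R.normalCore.comap (mulRightIso S) := hxcore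
    rw [hb, Subgroup.mem_bot] at h1
    rw [h1, orderOf_one] at hx
    omega
  have hg : g ∈ R.normalCore.comap (mulRightIso S) := by rw [htop]; trivial
  obtain ⟨h, hh⟩ := hg σ
  exact ⟨h, hh.symm⟩

/-- An automorphism fixing the vertex `1` and normalizing the right multiplications is a group
automorphism. -/
theorem map_mul_of_normalizes {σ : cayleyGraph S ≃g cayleyGraph S} (h1 : σ 1 = 1)
    (hσ : ∀ g, ∃ h, σ * mulRightIso S g * σ⁻¹ = mulRightIso S h) (a b : G) :
    σ (a * b) = σ a * σ b := by
  obtain ⟨h, hh⟩ := hσ b⁻¹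
  have key : ∀ c, σ (c * b) = σ c * h⁻¹ := by
    intro c
    have := congrArg (fun τ : cayleyGraph S ≃g cayleyGraph S => τ (σ c)) hh
    simpa [RelIso.inv_apply_self] using this
  have hb := key 1
  rw [one_mul, h1, one_mul] at hb
  rw [key, hb]

/-- A simple group generated by an element `x` of prime order `p ≥ 5` and an involution `y`, such that
no automorphism inverts `x` and fixes `y`, has `Γ_k(G, x, y)` as a graphical regular representation
when `p > 3 * ⌊(k - 1) / 2⌋`. -/
theorem isGRR_gammaGraph [Finite G] [IsSimpleGroup G] {k p : ℕ} (hk : 5 ≤ k) (hp : p.Prime)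
    (h5 : 5 ≤ p) (hkp : 3 * ((k - 1) / 2) < p) (hx : orderOf x = p) (hy : orderOf y = 2)
    (hgen : Subgroup.closure {x, y} = ⊤) (hno : ¬ ∃ φ : G ≃* G, φ x = x⁻¹ ∧ φ y = y) :
    IsGRR (gammaGraph k x y) G := by
  have hyy : y * y = 1 := by rw [← pow_two, ← hy, pow_orderOf_eq_one]
  have hN := zpow_eq_one_of_conj hp (by omega) hgen hx hy
  have hx1 : x ≠ 1 := by
    rintro rfl
    rw [orderOf_one] at hx
    omega
  have hynot : ∀ i : ℤ, y ≠ x ^ i := by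
    intro i h
    have hdvd := orderOf_dvd_of_mem_zpowers (x := x) (y := y) ⟨i, h.symm⟩
    rw [hx, hy, Nat.prime_dvd_prime_iff_eq Nat.prime_two hp] at hdvd
    omega
  have hD := inGeneralPosition_pair hx1 hyy hynot hN
  have hinv := inv_mem_connectionSet k x y hy
  have hone := one_notMem_connectionSet k x y (by omega) hy
  set m := (k - 1) / 2 with hm
  have hm2 : 2 ≤ m := by omega
  have hS : IsPowersUnion (connectionSet k x y) (if Odd k then {y} else {y, x⁻¹ * y * x}) x m := by
    intro a
    have : (∃ j : ℕ, 1 ≤ j ∧ j ≤ m ∧ (a = x ^ j ∨ a = (x ^ j)⁻¹)) ↔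
        (∃ i : ℤ, i ≠ 0 ∧ -m ≤ i ∧ i ≤ m ∧ a = x ^ i) := by
      constructor
      · rintro ⟨j, h1, h2, rfl | rfl⟩
        · exact ⟨j, by omega, by omega, by omega, by simp⟩
        · exact ⟨-j, by omega, by omega, by omega, by simp⟩
      · rintro ⟨i, h1, h2, h3, rfl⟩
        obtain ⟨j, rfl | rfl⟩ := i.eq_nat_or_neg
        · exact ⟨j, by omega, by omega, Or.inl (by simp)⟩
        · exact ⟨j, by omega, by omega, Or.inr (by simp)⟩
    rw [← this]
    rfl
  refine isGRR_of_fix_one fun σ h1 => ?_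
  by_cases hodd : Odd k
  · rw [if_pos hodd] at hS
    have hD' : InGeneralPosition {y} x := hD.mono (by simp)
    have hσx := map_mul_eq_or hinv hone hS hD' (by omega) hm2
    have hσy : ∀ (σ : cayleyGraph (connectionSet k x y) ≃g cayleyGraph (connectionSet k x y)) g,
        σ (y * g) = y * σ g := by
      intro σ g
      obtain ⟨d, hd, h⟩ := exists_map_mul_eq hinv hone hS hD' (by omega) hm2 σ
        (Set.mem_singleton y) g
      rwa [Set.mem_singleton_iff.1 hd] at h
    have hcard := card_oneStabilizer_le hp h5 hx hyy hgen hσx hσy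
    have hmul := map_mul_of_normalizes h1 (exists_conj_mulRightIso_eq hp h5 hx hcard σ)
    have hy1 : σ y = y := by simpa [h1] using hσy σ 1
    have hx1 : σ x = x ∨ σ x = x⁻¹ := by simpa [h1] using hσx σ 1
    rcases hx1 with hx1 | hx1
    · refine forall_of_mul_left hgen h1 ?_ ?_
      · intro g hg
        rw [hmul, hx1, hg]
      · intro g hg
        rw [hmul, hy1, hg]
    · exact absurd ⟨MulEquiv.mk' σ.toEquiv hmul, hx1, hy1⟩ hno
  · rw [if_neg hodd] at hS
    have hpair : ∀ {d : G}, d ∈ ({y, x⁻¹ * y * x} : Set G) → ∀ g,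
        σ (d * g) = y * σ g ∨ σ (d * g) = x⁻¹ * y * x * σ g := by
      intro d hd g
      obtain ⟨d', hd' | hd', h⟩ := exists_map_mul_eq hinv hone hS hD (by omega) hm2 σ hd g
      · left; rw [h, hd']
      · right; rw [h, Set.mem_singleton_iff.1 hd']
    exact eq_one_of_quadrangle (σ := σ.toEquiv) hgen (by omega) hN hno h1
      (map_mul_eq_or hinv hone hS hD (by omega) hm2 σ) (hpair (Or.inl rfl)) (hpair (Or.inr rfl))

end Regular

/-! ### A Jordan-type theorem for cycles of prime length -/

section Jordan

open MulAction Equiv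

/-- In a group whose order is not divisible by `p ^ 2`, subgroups of order `p` are conjugate. -/
theorem exists_conj_mem_zpowers {K : Type*} [Group K] [Finite K] {p : ℕ} (hp : p.Prime)
    (hcard : ¬ p ^ 2 ∣ Nat.card K) {x x' : K} (hx : orderOf x = p) (hx' : orderOf x' = p) :
    ∃ k : K, k * x' * k⁻¹ ∈ Subgroup.zpowers x := by
  have : Fact p.Prime := ⟨hp⟩
  have key : ∀ z : K, orderOf z = p → ∃ P : Sylow p K, (P : Subgroup K) = Subgroup.zpowers z := by
    intro z hz
    have hpg : IsPGroup p (Subgroup.zpowers z) :=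
      IsPGroup.of_card (n := 1) (by rw [Nat.card_zpowers, hz, pow_one])
    obtain ⟨P, hP⟩ := hpg.exists_le_sylow
    refine ⟨P, (Subgroup.eq_of_le_of_card_ge hP ?_).symm⟩
    obtain ⟨n, hn⟩ := (IsPGroup.iff_card (p := p)).1 P.isPGroup'
    rw [Nat.card_zpowers, hz]
    have hn1 : n ≤ 1 := by
      by_contra hc
      push Not at hc
      exact hcard ((pow_dvd_pow p hc).trans (hn ▸ Subgroup.card_subgroup_dvd_card (P : Subgroup K)))
    calc Nat.card P = p ^ n := hn
      _ ≤ p ^ 1 := Nat.pow_le_pow_right hp.pos hn1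
      _ = p := pow_one p
  obtain ⟨P, hP⟩ := key x hx
  obtain ⟨P', hP'⟩ := key x' hx'
  obtain ⟨k, hk⟩ := MulAction.exists_smul_eq K P' P
  refine ⟨k, ?_⟩
  rw [← hP, ← hk]
  have : x' ∈ (P' : Subgroup K) := by rw [hP']; exact Subgroup.mem_zpowers x'
  exact ⟨x', this, rfl⟩

variable {α : Type*} [Fintype α] [DecidableEq α]

-- A permutation commuting with the cycle is determined on its support by the image of one point,
-- which some power of the cycle also attains.
omit [Fintype α] [DecidableEq α] in
theorem mem_zpowers_of_commute_of_isCycle {x u : Perm α} (hx : x.IsCycle) (hu : Commute u x)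
    (hfix : ∀ a, x a = a → u a = a) : u ∈ Subgroup.zpowers x := by
  have hcyc := hx
  obtain ⟨a, ha, -⟩ := hx
  have hua : x (u a) ≠ u a := by
    intro h
    have h1 := hfix _ h
    rw [u.injective.eq_iff] at h1
    rw [h1] at h
    exact ha h
  obtain ⟨i, hi⟩ := hcyc.exists_zpow_eq ha hua
  refine ⟨i, ?_⟩
  ext b
  simp only
  by_cases hb : x b = b
  · rw [hfix b hb, Perm.zpow_apply_eq_self_of_apply_eq_self hb]
  · obtain ⟨l, rfl⟩ := hcyc.exists_zpow_eq ha hb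
    have h1 : u ((x ^ l) a) = (x ^ l) (u a) := by
      rw [← Perm.mul_apply, ← Perm.mul_apply, (hu.zpow_right l).eq]
    rw [h1, ← hi, ← Perm.mul_apply, ← Perm.mul_apply, ← zpow_add, ← zpow_add, add_comm]

omit [DecidableEq α] in
theorem card_fixingSubgroup_perm (s : Set α) :
    Nat.card (fixingSubgroup (Perm α) s) = (Nat.card α - s.ncard).factorial := by
  have h1 := (Equiv.Perm.isMultiplyPretransitive α s.ncard).index_of_fixingSubgroup_mul
    (s := s) rfl
  have h2 := Subgroup.card_mul_index (fixingSubgroup (Perm α) s)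
  rw [Nat.card_perm, ← h1, mul_comm] at h2
  exact Nat.eq_of_mul_eq_mul_left
    (Nat.pos_of_ne_zero Subgroup.index_ne_zero_of_finite) h2

/-- A transitive permutation group containing a cycle of prime length greater than half of the
degree is multiply transitive. -/
theorem isMultiplyPretransitive_of_isCycle {H : Subgroup (Perm α)} [IsPretransitive H α]
    {x : Perm α} (hxH : x ∈ H) (hx : x.IsCycle) (hp : x.support.card.Prime)
    (hlt : Fintype.card α < 2 * x.support.card) (hle : x.support.card + 3 ≤ Fintype.card α) :
    IsPreprimitive H α ∧ IsMultiplyPretransitive H α (Fintype.card α - x.support.card) := by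
  have hsub := Perm.isPretransitive_of_isCycle_mem hx hxH
  have hcards : Nat.card (SubMulAction.ofFixingSubgroup H ((x.support : Set α)ᶜ))
      = x.support.card := by
    have hset : (SubMulAction.ofFixingSubgroup H ((x.support : Set α)ᶜ) : Set α) = x.support := by
      ext a
      simp [SubMulAction.mem_ofFixingSubgroup_iff]
    change Nat.card (SubMulAction.ofFixingSubgroup H ((x.support : Set α)ᶜ) : Set α) = _
    rw [Nat.card_coe_set_eq, hset, Set.ncard_coe_finset]
  have hprim : IsPreprimitive (fixingSubgroup H ((x.support : Set α)ᶜ))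
      (SubMulAction.ofFixingSubgroup H ((x.support : Set α)ᶜ)) :=
    IsPreprimitive.of_prime_card (by rw [hcards]; exact hp)
  -- The support is more than half of the points, so primitivity there spreads to the whole set.
  have hprimH : IsPreprimitive H α := by
    refine IsPreprimitive.of_card_lt
      (f := SubMulAction.ofFixingSubgroup_equivariantMap H ((x.support : Set α)ᶜ)) ?_
    rw [← Set.image_univ, Set.ncard_image_of_injective _
      SubMulAction.ofFixingSubgroup_equivariantMap_injective, Set.ncard_univ, hcards,
      Nat.card_eq_fintype_card]
    exact hlt
  refine ⟨hprimH, ?_⟩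
  have hcompl : ((x.support : Set α)ᶜ).ncard = Fintype.card α - x.support.card := by
    rw [Set.ncard_compl, Set.ncard_coe_finset, Nat.card_eq_fintype_card]
  have h2 := hp.two_le
  -- Jordan's theorem gives transitivity of one degree more than the number of fixed points of x.
  have hmp := hprimH.isMultiplyPreprimitive (s := (x.support : Set α)ᶜ)
    (n := Fintype.card α - x.support.card - 1) (by rw [hcompl]; omega)
    (by rw [Nat.card_eq_fintype_card]; omega) hprim
  have := hmp.isMultiplyPretransitive
  refine isMultiplyPretransitive_of_le
    (n := Fintype.card α - x.support.card - 1 + 2) (by omega)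
    (by rw [Nat.card_eq_fintype_card]; omega)

/-- A sufficiently transitive group containing a cycle of prime length contains, for each
permutation `π` of the points fixed by the cycle, an element that normalizes the cyclic group and acts
as `π` on these points. -/
theorem exists_normalizing_extension {H : Subgroup (Perm α)}
    {x : Perm α} (hxH : x ∈ H) (hx : x.IsCycle) (hp : x.support.card.Prime)
    (hmt : IsMultiplyPretransitive H α (Fintype.card α - x.support.card))
    (π : Perm α) (hπ : ∀ a, x a = a ↔ x (π a) = π a) :
    ∃ g ∈ H, (∀ a, x a = a → g a = π a) ∧ g * x * g⁻¹ ∈ Subgroup.zpowers x := by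
  set F : Set α := (x.support : Set α)ᶜ with hF
  have hmemF : ∀ a, a ∈ F ↔ x a = a := by intro a; simp [hF]
  have hFcard : F.ncard = Fintype.card α - x.support.card := by
    rw [hF, Set.ncard_compl, Set.ncard_coe_finset, Nat.card_eq_fintype_card]
  have hFcard' : Nat.card α - F.ncard = x.support.card := by
    have := x.support.card_le_univ
    rw [hFcard, Nat.card_eq_fintype_card]; omega
  -- an element of `H` acting as `π` on the fixed points
  obtain ⟨e⟩ : Nonempty (Fin (Fintype.card α - x.support.card) ≃ F) := by
    rw [← hFcard]
    exact ⟨(Finite.equivFinOfCardEq (Nat.card_coe_set_eq F)).symm⟩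
  let ι : Fin (Fintype.card α - x.support.card) ↪ α :=
    e.toEmbedding.trans (Function.Embedding.subtype _)
  obtain ⟨⟨h, hH⟩, hh⟩ := exists_smul_eq H ι (ι.trans π.toEmbedding)
  have hhπ : ∀ a, x a = a → h a = π a := by
    intro a ha
    have h1 := DFunLike.congr_fun hh (e.symm ⟨a, (hmemF a).2 ha⟩)
    simpa [ι, Subgroup.smul_def] using h1
  have hhF : ∀ a, x a = a → x (h⁻¹ a) = h⁻¹ a := by
    intro a ha
    have h1 : x (π⁻¹ a) = π⁻¹ a := by rw [hπ]; simpa using ha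
    have h2 := hhπ _ h1
    have h3 : h⁻¹ a = π⁻¹ a := by
      rw [Perm.inv_eq_iff_eq, h2]; simp
    rw [h3]; exact h1
  -- conjugation within the pointwise stabilizer of the fixed points
  set K := H ⊓ fixingSubgroup (Perm α) F with hK
  have hmemK : ∀ k, k ∈ K ↔ k ∈ H ∧ ∀ a, x a = a → k a = a := by
    intro k
    rw [hK, Subgroup.mem_inf, mem_fixingSubgroup_iff]
    simp [hmemF]
  have hxK : x ∈ K := (hmemK x).2 ⟨hxH, fun a ha => ha⟩
  have hxK' : h * x * h⁻¹ ∈ K := by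
    refine (hmemK _).2 ⟨H.mul_mem (H.mul_mem hH hxH) (H.inv_mem hH), fun a ha => ?_⟩
    rw [Perm.mul_apply, Perm.mul_apply, hhF a ha]; simp
  -- K fixes everything off the support, so its order divides p!, which p² does not divide. Sylow
  -- conjugacy in K then corrects h, as in a Frattini argument.
  have hcardK : ¬ x.support.card ^ 2 ∣ Nat.card K := by
    intro hdvd
    have h1 := hdvd.trans (Subgroup.card_dvd_of_le (inf_le_right : K ≤ fixingSubgroup (Perm α) F))
    rw [card_fixingSubgroup_perm, hFcard'] at h1
    have h2 : x.support.card.factorial = x.support.card * (x.support.card - 1).factorial :=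
      (Nat.mul_factorial_pred hp.ne_zero).symm
    rw [h2, pow_two] at h1
    have h3 := Nat.dvd_of_mul_dvd_mul_left hp.pos h1
    rw [hp.dvd_factorial] at h3
    have := hp.pos
    omega
  obtain ⟨⟨k, hkK⟩, hk⟩ := exists_conj_mem_zpowers (K := K) hp hcardK (x := ⟨x, hxK⟩)
    (x' := ⟨h * x * h⁻¹, hxK'⟩) (by rw [Subgroup.orderOf_mk, hx.orderOf])
    (by rw [Subgroup.orderOf_mk, ← hx.orderOf]; exact (MulAut.conj h).orderOf_eq x)
  refine ⟨k * h, H.mul_mem ((hmemK k).1 hkK).1 hH, fun a ha => ?_, ?_⟩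
  · rw [Perm.mul_apply, hhπ a ha]
    exact ((hmemK k).1 hkK).2 _ ((hπ a).1 ha)
  · obtain ⟨i, hi⟩ := hk
    refine ⟨i, ?_⟩
    have := congrArg Subtype.val hi
    simp only [Subgroup.coe_zpow, Subgroup.coe_mul, InvMemClass.coe_inv] at this
    simp only [this, mul_inv_rev, mul_assoc]

/-- A transitive permutation group containing a cycle of prime length, greater than half of the
degree and with at least three fixed points, contains the alternating group. -/
theorem alternatingGroup_le_of_isCycle_mem {H : Subgroup (Perm α)} [IsPretransitive H α]
    {x : Perm α} (hxH : x ∈ H) (hx : x.IsCycle) (hp : x.support.card.Prime)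
    (hlt : Fintype.card α < 2 * x.support.card) (hle : x.support.card + 3 ≤ Fintype.card α) :
    alternatingGroup α ≤ H := by
  obtain ⟨hprim, hmt⟩ := isMultiplyPretransitive_of_isCycle hxH hx hp hlt hle
  have hcompl : 2 < x.supportᶜ.card := by
    rw [Finset.card_compl]; omega
  obtain ⟨a, b, c, ha, hb, hc, hab, hac, hbc⟩ := Finset.two_lt_card_iff.1 hcompl
  simp only [Finset.mem_compl, Perm.notMem_support] at ha hb hc
  have hswap : ∀ u v, x u = u → x v = v → Commute (swap u v) x := by
    intro u v hu hv
    have h := Equiv.mul_swap_eq_swap_mul x u v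
    rw [hu, hv] at h
    exact h.symm
  have hiff : ∀ π : Perm α, Commute π x → ∀ w, x w = w ↔ x (π w) = π w := by
    intro π h w
    rw [← Perm.mul_apply, ← h.eq, Perm.mul_apply, π.injective.eq_iff]
  set π₁ := swap a b
  set π₂ := swap a c
  have h1 : Commute π₁ x := hswap a b ha hb
  have h2 : Commute π₂ x := hswap a c ha hc
  obtain ⟨g₁, hg₁, hg₁π, i, hi⟩ := exists_normalizing_extension hxH hx hp hmt π₁ (hiff π₁ h1)
  obtain ⟨g₂, hg₂, hg₂π, j, hj⟩ := exists_normalizing_extension hxH hx hp hmt π₂ (hiff π₂ h2)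
  simp only at hi hj
  have hA : ∀ w, x w = w → (g₁ * g₂) w = (π₁ * π₂) w := by
    intro w hw
    rw [Perm.mul_apply, hg₂π w hw, hg₁π _ ((hiff π₂ h2 w).1 hw), Perm.mul_apply]
  have hB : ∀ w, x w = w → (g₂ * g₁) w = (π₂ * π₁) w := by
    intro w hw
    rw [Perm.mul_apply, hg₁π w hw, hg₂π _ ((hiff π₁ h1 w).1 hw), Perm.mul_apply]
  have hAx : (g₁ * g₂) * x * (g₁ * g₂)⁻¹ = x ^ (i * j) := by
    have : (g₁ * g₂) * x * (g₁ * g₂)⁻¹ = g₁ * (g₂ * x * g₂⁻¹) * g₁⁻¹ := by group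
    rw [this, ← hj, ← conj_zpow, ← hi, zpow_mul]
  have hBx : (g₂ * g₁) * x * (g₂ * g₁)⁻¹ = x ^ (i * j) := by
    have : (g₂ * g₁) * x * (g₂ * g₁)⁻¹ = g₂ * (g₁ * x * g₁⁻¹) * g₂⁻¹ := by group
    rw [this, ← hi, ← conj_zpow, ← hj, mul_comm i j, zpow_mul]
  set t := (π₂ * π₁)⁻¹ * (π₁ * π₂) with ht
  set s := (g₂ * g₁)⁻¹ * (g₁ * g₂) with hs
  have htx : Commute t x := ((h2.mul_left h1).inv_left).mul_left (h1.mul_left h2)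
  -- Both g₁ and g₂ act on ⟨x⟩ by power maps, which commute; so their commutator centralizes x.
  have hsx : Commute s x := by
    have h4 : (g₁ * g₂) * x = (g₂ * g₁) * x * (g₂ * g₁)⁻¹ * (g₁ * g₂) := by
      rw [hBx, ← hAx]; group
    have h5 : s * x = (g₂ * g₁)⁻¹ * ((g₁ * g₂) * x) := by rw [hs, mul_assoc]
    change s * x = x * s
    rw [h5, h4, hs]; group
  -- On the fixed points of x, s agrees with the commutator t of the transpositions; hence s and t
  -- differ by a power of x, and t lies in H.
  have hu : s * t⁻¹ ∈ Subgroup.zpowers x := by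
    refine mem_zpowers_of_commute_of_isCycle hx (hsx.mul_left htx.inv_left) fun w hw => ?_
    have h4 : x (t⁻¹ w) = t⁻¹ w := (hiff t⁻¹ htx.inv_left w).1 hw
    rw [Perm.mul_apply, hs, Perm.mul_apply, hA _ h4, Perm.inv_eq_iff_eq, hB w hw]
    have h5 : (π₁ * π₂) (t⁻¹ w) = ((π₁ * π₂) * t⁻¹) w := rfl
    rw [h5, ht]
    congr 1
    group
  have hsH : s ∈ H := H.mul_mem (H.inv_mem (H.mul_mem hg₂ hg₁)) (H.mul_mem hg₁ hg₂)
  have htH : t ∈ H := by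
    have h4 : Subgroup.zpowers x ≤ H := by simpa using hxH
    have h5 : t = (s * t⁻¹)⁻¹ * s := by group
    rw [h5]
    exact H.mul_mem (H.inv_mem (h4 hu)) hsH
  -- As π₁ and π₂ are involutions, t is the square of the 3-cycle π₁π₂.
  have ht3 : t.IsThreeCycle := by
    have h4 : t = (π₁ * π₂) * (π₁ * π₂) := by
      rw [ht, mul_inv_rev]
      simp only [π₁, π₂, swap_inv]
    rw [h4]
    exact (Perm.isThreeCycle_swap_mul_swap_same hab hac hbc).isThreeCycle_sq
  exact Perm.alternatingGroup_le_of_isPreprimitive_of_isThreeCycle_mem hprim ht3 htH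

end Jordan

/-! ### Automorphisms of the alternating group inverting a long cycle -/

section Automorphism

open MulAction Equiv

variable {α : Type*} [Fintype α] [DecidableEq α]

theorem lt_choose_of_two_le {n l : ℕ} (hn : 4 ≤ n) (hl : 2 ≤ l) (hln : 2 * l ≤ n) :
    n < n.choose l := by
  induction l, hl using Nat.le_induction with
  | base =>
    rw [Nat.choose_two_right]
    refine Nat.lt_of_succ_le ((Nat.le_div_iff_mul_le (by norm_num)).2 ?_)
    have : n * 3 ≤ n * (n - 1) := Nat.mul_le_mul_left n (by omega)
    omega
  | succ l hl ih =>
    exact (ih (by omega)).trans_le (Nat.choose_le_succ_of_lt_half_left (by omega))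

open scoped Pointwise in
/-- A subgroup of the alternating group of index equal to the degree that contains a cycle of prime
length greater than half of the degree, with at least three fixed points, is a point stabilizer. -/
theorem exists_eq_stabilizer {M : Subgroup (alternatingGroup α)} {x : alternatingGroup α}
    (hxM : x ∈ M) (hx : (x : Perm α).IsCycle) (hp : (x : Perm α).support.card.Prime)
    (hlt : Fintype.card α < 2 * (x : Perm α).support.card)
    (hle : (x : Perm α).support.card + 3 ≤ Fintype.card α)
    (hindex : M.index = Fintype.card α) : ∃ b : α, M = stabilizer (alternatingGroup α) b := by
  have hp2 := hp.two_le
  have htransA : IsPretransitive (alternatingGroup α) α :=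
    alternatingGroup.isPretransitive_of_three_le_card α (by rw [Nat.card_eq_fintype_card]; omega)
  -- the subgroup is not transitive
  have hnt : ¬ IsPretransitive M α := by
    intro hM
    have hM' : IsPretransitive (M.map (alternatingGroup α).subtype) α := by
      refine ⟨fun u v => ?_⟩
      obtain ⟨⟨g, hg⟩, h⟩ := exists_smul_eq M u v
      exact ⟨⟨g, ⟨g, hg, rfl⟩⟩, h⟩
    have hA := alternatingGroup_le_of_isCycle_mem (H := M.map (alternatingGroup α).subtype)
      ⟨x, hxM, rfl⟩ hx hp hlt hle
    have : M = ⊤ := by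
      rw [eq_top_iff]
      intro g _
      obtain ⟨g', hg', h⟩ := hA g.2
      have : g' = g := Subtype.ext h
      rwa [← this]
    rw [this, Subgroup.index_top] at hindex
    omega
  obtain ⟨a, ha, hcyc⟩ := id hx
  -- a point outside the orbit of the support
  obtain ⟨b, hb⟩ : ∃ b, b ∉ orbit M a := by
    by_contra hc
    push Not at hc
    refine hnt ⟨fun u v => ?_⟩
    obtain ⟨g, hg⟩ := hc u
    obtain ⟨g', hg'⟩ := hc v
    exact ⟨g' * g⁻¹, by simp only at hg hg'; rw [← hg, ← hg', smul_smul, inv_mul_cancel_right]⟩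
  have hdisj : ∀ w ∈ orbit M b, w ∉ (x : Perm α).support := by
    intro w hw hws
    apply hb
    obtain ⟨i, hi⟩ := hcyc (Perm.mem_support.1 hws)
    have hwa : w ∈ orbit M a := ⟨⟨x ^ i, M.zpow_mem hxM i⟩, by
      rw [← hi]
      change ((x ^ i : alternatingGroup α) : Perm α) a = _
      rw [Subgroup.coe_zpow]⟩
    rw [← orbit_eq_iff] at hwa hw
    rw [← hwa, hw]
    exact mem_orbit_self b
  classical
  set O : Finset α := (orbit M b).toFinset with hO
  have hOcard : O.card + (x : Perm α).support.card ≤ Fintype.card α := by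
    rw [← Finset.card_union_of_disjoint]
    · exact Finset.card_le_univ _
    · rw [Finset.disjoint_left]
      intro w hw
      exact hdisj w (by simpa [hO] using hw)
  have hbO : b ∈ O := by simp [hO]
  have hOpos : 0 < O.card := Finset.card_pos.2 ⟨b, hbO⟩
  have hMO : M ≤ stabilizer (alternatingGroup α)
      (⟨O, Set.powersetCard.mem_iff.2 rfl⟩ : Set.powersetCard α O.card) := by
    intro g hg
    rw [mem_stabilizer_iff]
    apply Subtype.ext
    change g • O = O
    refine Finset.eq_of_subset_of_card_le ?_ (by simp)
    intro w hw
    obtain ⟨v, hv, rfl⟩ := Finset.mem_smul_finset.1 hw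
    have hv' : v ∈ orbit M b := by simpa [hO] using hv
    have : (⟨g, hg⟩ : M) • v ∈ orbit M b := (mem_orbit_of_mem_orbit _ hv')
    simpa [hO] using this
  have htr : IsPretransitive (alternatingGroup α) (Set.powersetCard α O.card) :=
    Set.powersetCard.isPretransitive_alternatingGroup (by rw [Nat.card_eq_fintype_card]; omega)
  -- M stabilizes O, whose conjugates number n.choose |O|; this divides the index n of M. As |O| ≤ n
  -- - p < n/2, only |O| = 1 is possible.
  have hchoose : (Fintype.card α).choose O.card ≤ Fintype.card α := by
    have h1 := Subgroup.index_dvd_of_le hMO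
    rw [index_stabilizer_of_transitive, hindex, Set.powersetCard.card,
      Nat.card_eq_fintype_card] at h1
    exact Nat.le_of_dvd (by omega) h1
  have hO1 : O.card = 1 := by
    by_contra hne
    exact absurd (lt_choose_of_two_le (n := Fintype.card α) (l := O.card) (by omega) (by omega)
      (by omega)) (by omega)
  refine ⟨b, ?_⟩
  have hMb : M ≤ stabilizer (alternatingGroup α) b := by
    intro g hg
    rw [mem_stabilizer_iff]
    have : g • b ∈ O := by
      have : (⟨g, hg⟩ : M) • b ∈ orbit M b := mem_orbit _ _
      simpa [hO] using this
    exact Finset.card_le_one.1 hO1.le _ this _ hbO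
  refine Subgroup.eq_of_le_of_card_ge hMb ?_
  have h1 := Subgroup.card_mul_index M
  have h2 := Subgroup.card_mul_index (stabilizer (alternatingGroup α) b)
  rw [index_stabilizer_of_transitive, Nat.card_eq_fintype_card (α := α)] at h2
  rw [hindex, ← h2] at h1
  exact (Nat.eq_of_mul_eq_mul_right (by omega) h1).ge

/-- An automorphism of the alternating group that inverts a cycle of prime length greater than half of
the degree, with at least three fixed points, is induced by a permutation. -/
theorem exists_perm_of_mulEquiv {x : alternatingGroup α}
    (hx : (x : Perm α).IsCycle) (hp : (x : Perm α).support.card.Prime)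
    (hlt : Fintype.card α < 2 * (x : Perm α).support.card)
    (hle : (x : Perm α).support.card + 3 ≤ Fintype.card α)
    (φ : alternatingGroup α ≃* alternatingGroup α) (hφ : φ x = x⁻¹) :
    ∃ s : Perm α, ∀ (g : alternatingGroup α) (c : α),
      s ((g : Perm α) c) = (φ g : Perm α) (s c) := by
  have hp2 := hp.two_le
  have htransA : IsPretransitive (alternatingGroup α) α :=
    alternatingGroup.isPretransitive_of_three_le_card α (by rw [Nat.card_eq_fintype_card]; omega)
  obtain ⟨f, hf⟩ : ∃ f, f ∉ (x : Perm α).support := by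
    by_contra hc
    push Not at hc
    rw [Finset.eq_univ_of_forall hc, Finset.card_univ] at hle
    omega
  rw [Perm.notMem_support] at hf
  -- The stabilizer of the fixed point f contains x⁻¹, so its image contains x and again has index
  -- n.
  obtain ⟨b, hb⟩ := exists_eq_stabilizer
    (M := (stabilizer (alternatingGroup α) f).map φ.toMonoidHom) (x := x)
    ⟨x⁻¹, (stabilizer (alternatingGroup α) f).inv_mem hf, by simp [hφ]⟩ hx hp hlt hle (by
      rw [Subgroup.index_map_of_bijective φ.bijective, index_stabilizer_of_transitive,
        Nat.card_eq_fintype_card])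
  have hstab : ∀ g : alternatingGroup α, g • f = f ↔ φ g • b = b := by
    intro g
    rw [← mem_stabilizer_iff, ← mem_stabilizer_iff, ← hb]
    exact (Subgroup.mem_map_iff_mem φ.injective).symm
  have hstab' : ∀ g g' : alternatingGroup α, g • f = g' • f ↔ φ g • b = φ g' • b := by
    intro g g'
    rw [← inv_smul_eq_iff, smul_smul, hstab, map_mul, map_inv, mul_smul, inv_smul_eq_iff]
  -- The inducing permutation sends r c • f to φ (r c) • b; matching stabilizers make this
  -- independent of the choice of r c.
  choose r hr using fun c : α => exists_smul_eq (alternatingGroup α) f c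
  have hinj : Function.Injective fun c => φ (r c) • b := by
    intro c c' h
    simp only at h
    rw [← hstab', hr, hr] at h
    exact h
  refine ⟨Equiv.ofBijective _ (Finite.injective_iff_bijective.1 hinj), fun g c => ?_⟩
  simp only [Equiv.ofBijective_apply]
  change φ (r (g • c)) • b = φ g • φ (r c) • b
  rw [smul_smul, ← map_mul, ← hstab', hr, mul_smul, hr]

end Automorphism

/-! ### An explicit involution for the standard p-cycle -/

section Model

open MulAction Equiv

variable {p q : ℕ}

/-- The cycle of length `p` on `ZMod p ⊕ Fin q` with `q` fixed points. -/
def shiftPerm (p q : ℕ) : Perm (ZMod p ⊕ Fin q) :=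
  Equiv.sumCongr (Equiv.addRight 1) (Equiv.refl _)

@[simp]
theorem shiftPerm_inl (i : ZMod p) : shiftPerm p q (Sum.inl i) = Sum.inl (i + 1) := rfl

@[simp]
theorem shiftPerm_inr (j : Fin q) : shiftPerm p q (Sum.inr j) = Sum.inr j := rfl

@[simp]
theorem shiftPerm_inv_inl (i : ZMod p) : (shiftPerm p q)⁻¹ (Sum.inl i) = Sum.inl (i - 1) := by
  rw [Perm.inv_eq_iff_eq]; simp

@[simp]
theorem shiftPerm_inv_inr (j : Fin q) : (shiftPerm p q)⁻¹ (Sum.inr j) = Sum.inr j := by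
  rw [Perm.inv_eq_iff_eq]; simp

theorem shiftPerm_pow_inl (i : ZMod p) (k : ℕ) :
    (shiftPerm p q ^ k) (Sum.inl i) = Sum.inl (i + k) := by
  induction k with
  | zero => simp
  | succ k ih => rw [pow_succ', Perm.mul_apply, ih]; simp [add_assoc]

theorem shiftPerm_pow_inr (j : Fin q) (k : ℕ) :
    (shiftPerm p q ^ k) (Sum.inr j) = Sum.inr j := by
  induction k with
  | zero => simp
  | succ k ih => rw [pow_succ', Perm.mul_apply, ih]; simp

theorem orderOf_shiftPerm [Fact p.Prime] : orderOf (shiftPerm p q) = p := by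
  apply orderOf_eq_prime
  · ext c
    rcases c with i | j
    · rw [shiftPerm_pow_inl]; simp
    · rw [shiftPerm_pow_inr]; simp
  · intro h
    have := DFunLike.congr_fun h (Sum.inl 0)
    simp at this

/-- The map exchanging the residues less than `q` with the points of `Fin q`. -/
def exchangeFun (p q : ℕ) : ZMod p ⊕ Fin q → ZMod p ⊕ Fin q
  | Sum.inl i => if h : i.val < q then Sum.inr ⟨i.val, h⟩ else Sum.inl i
  | Sum.inr j => Sum.inl ((j : ℕ) : ZMod p)

theorem exchangeFun_involutive [NeZero p] (hqp : q ≤ p) :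
    Function.Involutive (exchangeFun p q) := by
  rintro (i | j)
  · by_cases h : i.val < q
    · simp [exchangeFun, h]
    · simp [exchangeFun, h]
  · have : ((j : ℕ) : ZMod p).val = j := ZMod.val_cast_of_lt (j.2.trans_le hqp)
    simp [exchangeFun, this]

theorem swap_commute_of_fixed {α : Type*} [DecidableEq α] {f : Perm α} {u v : α} (hu : f u = u)
    (hv : f v = v) : Commute f (swap u v) := by
  have h := Equiv.mul_swap_eq_swap_mul f u v
  rwa [hu, hv] at h

/-- An even involution exchanging the fixed points of the cycle with an interval of residues, moving the
residue following the interval and fixing the residue preceding it. -/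
theorem exists_involution_model [Fact p.Prime] (hqp : q + 5 ≤ p) :
    ∃ Y : Perm (ZMod p ⊕ Fin q), Perm.sign Y = 1 ∧ Y * Y = 1 ∧
      (∀ j, Y (Sum.inr j) = Sum.inl ((j : ℕ) : ZMod p)) ∧
      Y (Sum.inl (-1)) = Sum.inl (-1) ∧ Y (Sum.inl (q : ZMod p)) ≠ Sum.inl (q : ZMod p) := by
  have hval : ∀ k, k < p → ((k : ℕ) : ZMod p).val = k := fun k hk => ZMod.val_cast_of_lt hk
  have hne : ∀ k l, k < p → l < p → k ≠ l → ((k : ℕ) : ZMod p) ≠ (l : ℕ) := by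
    intro k l hk hl hkl h
    have := congrArg ZMod.val h
    rw [hval k hk, hval l hl] at this
    exact hkl this
  have hm1 : (-1 : ZMod p) = ((p - 1 : ℕ) : ZMod p) := by
    rw [Nat.cast_sub (by omega)]; simp
  set a : ZMod p ⊕ Fin q := Sum.inl ((q : ℕ) : ZMod p) with ha
  set b : ZMod p ⊕ Fin q := Sum.inl ((q + 1 : ℕ) : ZMod p) with hb
  set c : ZMod p ⊕ Fin q := Sum.inl ((q + 2 : ℕ) : ZMod p) with hc
  set d : ZMod p ⊕ Fin q := Sum.inl ((q + 3 : ℕ) : ZMod p) with hd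
  set z : ZMod p ⊕ Fin q := Sum.inl (-1) with hz
  have hinl : ∀ k l, k < p → l < p → k ≠ l →
      (Sum.inl ((k : ℕ) : ZMod p) : ZMod p ⊕ Fin q) ≠ Sum.inl ((l : ℕ) : ZMod p) :=
    fun k l hk hl hkl h => hne k l hk hl hkl (Sum.inl_injective h)
  have hab : a ≠ b := hinl _ _ (by omega) (by omega) (by omega)
  have hac : a ≠ c := hinl _ _ (by omega) (by omega) (by omega)
  have had : a ≠ d := hinl _ _ (by omega) (by omega) (by omega)
  have hbc : b ≠ c := hinl _ _ (by omega) (by omega) (by omega)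
  have hbd : b ≠ d := hinl _ _ (by omega) (by omega) (by omega)
  have hcd : c ≠ d := hinl _ _ (by omega) (by omega) (by omega)
  have hza : z ≠ a := by rw [hz, hm1]; exact hinl _ _ (by omega) (by omega) (by omega)
  have hzb : z ≠ b := by rw [hz, hm1]; exact hinl _ _ (by omega) (by omega) (by omega)
  have hzc : z ≠ c := by rw [hz, hm1]; exact hinl _ _ (by omega) (by omega) (by omega)
  have hzd : z ≠ d := by rw [hz, hm1]; exact hinl _ _ (by omega) (by omega) (by omega)
  set E : Perm (ZMod p ⊕ Fin q) :=
    (exchangeFun_involutive (p := p) (q := q) (by omega)).toPerm with hE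
  have hEfix : ∀ k, q ≤ k → k < p → E (Sum.inl ((k : ℕ) : ZMod p)) = Sum.inl ((k : ℕ) : ZMod p) := by
    intro k hqk hk
    simp [hE, exchangeFun, hval k hk, hqk]
  have hEE : E * E = 1 := by
    ext1 w
    exact exchangeFun_involutive (p := p) (q := q) (by omega) w
  have hEinr : ∀ j, E (Sum.inr j) = Sum.inl ((j : ℕ) : ZMod p) := fun j => rfl
  have hEa : E a = a := hEfix _ (by omega) (by omega)
  have hEb : E b = b := hEfix _ (by omega) (by omega)
  have hEc : E c = c := hEfix _ (by omega) (by omega)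
  have hEd : E d = d := hEfix _ (by omega) (by omega)
  have hEz : E z = z := by rw [hz, hm1]; exact hEfix _ (by omega) (by omega)
  have h1 : Commute E (swap a b) := swap_commute_of_fixed hEa hEb
  have h2 : Commute E (swap c d) := swap_commute_of_fixed hEc hEd
  have h3 : Commute (swap a b) (swap c d) :=
    swap_commute_of_fixed (swap_apply_of_ne_of_ne hac.symm hbc.symm)
      (swap_apply_of_ne_of_ne had.symm hbd.symm)
  -- One or two extra transpositions among the residues q, …, q + 3 make the permutation even and
  -- move q. The bound q + 5 ≤ p keeps them clear of -1.
  rcases Int.units_eq_one_or (Perm.sign E) with hs | hs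
  · refine ⟨E * (swap a b * swap c d), ?_, ?_, ?_, ?_, ?_⟩
    · rw [Perm.sign_mul, Perm.sign_mul, hs, Perm.sign_swap hab, Perm.sign_swap hcd]; rfl
    · have h4 := h1.mul_right h2
      rw [← pow_two, h4.mul_pow, h3.mul_pow, pow_two, pow_two, pow_two, hEE, swap_mul_self,
        swap_mul_self, one_mul, one_mul]
    · intro j
      have hab' : swap a b (Sum.inr j) = Sum.inr j :=
        swap_apply_of_ne_of_ne (by simp [ha]) (by simp [hb])
      have hcd' : swap c d (Sum.inr j) = Sum.inr j :=
        swap_apply_of_ne_of_ne (by simp [hc]) (by simp [hd])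
      rw [Perm.mul_apply, Perm.mul_apply, hcd', hab', hEinr]
    · rw [Perm.mul_apply, Perm.mul_apply, swap_apply_of_ne_of_ne hzc hzd,
        swap_apply_of_ne_of_ne hza hzb, hEz]
    · rw [Perm.mul_apply, Perm.mul_apply, swap_apply_of_ne_of_ne hac had, swap_apply_left, hEb]
      exact hab.symm
  · refine ⟨E * swap a b, ?_, ?_, ?_, ?_, ?_⟩
    · rw [Perm.sign_mul, hs, Perm.sign_swap hab]; rfl
    · rw [← pow_two, h1.mul_pow, pow_two, pow_two, hEE, swap_mul_self, one_mul]
    · intro j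
      have hab' : swap a b (Sum.inr j) = Sum.inr j :=
        swap_apply_of_ne_of_ne (by simp [ha]) (by simp [hb])
      rw [Perm.mul_apply, hab', hEinr]
    · rw [Perm.mul_apply, swap_apply_of_ne_of_ne hza hzb, hEz]
    · rw [Perm.mul_apply, swap_apply_left, hEb]
      exact hab.symm

theorem isPretransitive_of_shiftPerm_mem [Fact p.Prime]
    {H : Subgroup (Perm (ZMod p ⊕ Fin q))}
    {Y : Perm (ZMod p ⊕ Fin q)} (hX : shiftPerm p q ∈ H) (hY : Y ∈ H) (hYY : Y * Y = 1)
    (hinr : ∀ j, Y (Sum.inr j) = Sum.inl ((j : ℕ) : ZMod p)) :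
    IsPretransitive H (ZMod p ⊕ Fin q) := by
  have hinl : ∀ i : ZMod p, ∃ h ∈ H, h (Sum.inl 0) = Sum.inl i := by
    intro i
    refine ⟨shiftPerm p q ^ i.val, H.pow_mem hX _, ?_⟩
    rw [shiftPerm_pow_inl]; simp
  have hall : ∀ c : ZMod p ⊕ Fin q, ∃ h ∈ H, h (Sum.inl 0) = c := by
    rintro (i | j)
    · exact hinl i
    · obtain ⟨h, hh, h0⟩ := hinl ((j : ℕ) : ZMod p)
      refine ⟨Y * h, H.mul_mem hY hh, ?_⟩
      rw [Perm.mul_apply, h0, ← hinr, ← Perm.mul_apply, hYY, Perm.one_apply]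
  refine ⟨fun c c' => ?_⟩
  obtain ⟨h, hh, h0⟩ := hall c
  obtain ⟨h', hh', h0'⟩ := hall c'
  refine ⟨⟨h' * h⁻¹, H.mul_mem hh' (H.inv_mem hh)⟩, ?_⟩
  change (h' * h⁻¹) c = c'
  rw [← h0', ← h0]
  simp

/-- No permutation inverts the cycle and commutes with the involution. -/
theorem not_exists_inverting_model [Fact p.Prime] (hqp : q + 5 ≤ p) (hq : 0 < q)
    {Y : Perm (ZMod p ⊕ Fin q)} (hYY : Y * Y = 1)
    (hinr : ∀ j, Y (Sum.inr j) = Sum.inl ((j : ℕ) : ZMod p))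
    (hm1 : Y (Sum.inl (-1)) = Sum.inl (-1)) (hne : Y (Sum.inl (q : ZMod p)) ≠ Sum.inl (q : ZMod p))
    (s : Perm (ZMod p ⊕ Fin q)) (hsX : ∀ c, s (shiftPerm p q c) = (shiftPerm p q)⁻¹ (s c))
    (hsY : ∀ c, s (Y c) = Y (s c)) : False := by
  have hval : ∀ k, k < p → ((k : ℕ) : ZMod p).val = k := fun k hk => ZMod.val_cast_of_lt hk
  have hYY' : ∀ c, Y (Y c) = c := fun c => by rw [← Perm.mul_apply, hYY, Perm.one_apply]
  have hsinl : ∀ i, ∃ i', s (Sum.inl i) = Sum.inl i' := by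
    intro i
    rcases h : s (Sum.inl i) with i' | j
    · exact ⟨i', rfl⟩
    · have h1 := hsX (Sum.inl i)
      rw [h, shiftPerm_inv_inr, ← h, s.injective.eq_iff] at h1
      simp at h1
  have hsinr : ∀ j, ∃ j', s (Sum.inr j) = Sum.inr j' := by
    intro j
    rcases h : s (Sum.inr j) with i | j'
    · have h1 := hsX (Sum.inr j)
      rw [shiftPerm_inr, h, shiftPerm_inv_inl] at h1
      exact absurd (sub_eq_self.1 (Sum.inl_injective h1).symm) one_ne_zero
    · exact ⟨j', rfl⟩
  obtain ⟨c, hc⟩ := hsinl 0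
  have hsc : ∀ i : ZMod p, s (Sum.inl i) = Sum.inl (c - i) := by
    have hnat : ∀ k : ℕ, s (Sum.inl (k : ZMod p)) = Sum.inl (c - k) := by
      intro k
      induction k with
      | zero => simpa using hc
      | succ k ih =>
        have h1 := hsX (Sum.inl (k : ZMod p))
        rw [ih, shiftPerm_inv_inl, shiftPerm_inl] at h1
        rw [Nat.cast_succ, h1]
        congr 1
        ring
    intro i
    have := hnat i.val
    simpa using this
  -- The residues below q are those that Y sends to fixed points of the cycle; a permutation
  -- commuting with Y and preserving the fixed points preserves this interval.
  have hlt : ∀ i : ZMod p, i.val < q → (c - i).val < q := by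
    intro i hi
    have h1 : Y (Sum.inl i) = Sum.inr ⟨i.val, hi⟩ := by
      have := hYY' (Sum.inr ⟨i.val, hi⟩)
      rw [hinr] at this
      simpa using this
    obtain ⟨j, hj⟩ := hsinr ⟨i.val, hi⟩
    have h2 := hsY (Sum.inl i)
    rw [h1, hj, hsc] at h2
    have h3 := congrArg Y h2
    rw [hYY', hinr] at h3
    rw [← Sum.inl_injective h3, hval _ (by omega)]
    exact j.2
  have hcq : c.val < q := by
    have := hlt 0 (by simpa using hq)
    simpa using this
  have hc1 : (c + 1).val = c.val + 1 := by
    have : c + 1 = ((c.val + 1 : ℕ) : ZMod p) := by simp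
    rw [this, hval _ (by omega)]
  -- Otherwise c + 1 is in the interval, but its reflection is -1, outside it.
  have hcq' : c.val + 1 = q := by
    by_contra hcon
    have h1 := hlt (c + 1) (by omega)
    have h2 : c - (c + 1) = ((p - 1 : ℕ) : ZMod p) := by
      rw [Nat.cast_sub (by omega)]; simp
    rw [h2, hval _ (by omega)] at h1
    omega
  have hcq'' : c + 1 = (q : ZMod p) := by
    rw [← hcq']; simp
  -- The reflection sends -1, fixed by Y, to q, which Y moves.
  have h1 := hsY (Sum.inl (-1))
  rw [hm1, hsc, sub_neg_eq_add, hcq''] at h1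
  exact hne h1.symm

end Model

/-! ### Transport of the model to an arbitrary element of order p -/

section Involution

open MulAction Equiv

/-- For each cycle `x` of suitable prime length there is an even involution `y` such that `x` and `y`
generate a transitive group, and no permutation inverts `x` and commutes with `y`. -/
theorem exists_involution {α : Type*} [Fintype α] [DecidableEq α] {p q : ℕ} (hp : p.Prime)
    (hcard : Fintype.card α = p + q) (hq : 0 < q) (hqp : q + 5 ≤ p) {x : Perm α}
    (hx : orderOf x = p) :
    ∃ y : Perm α, Perm.sign y = 1 ∧ y * y = 1 ∧ y ≠ 1 ∧
      (∀ H : Subgroup (Perm α), x ∈ H → y ∈ H → IsPretransitive H α) ∧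
      ¬ ∃ s : Perm α, (∀ c, s (x c) = x⁻¹ (s c)) ∧ ∀ c, s (y c) = y (s c) := by
  have : Fact p.Prime := ⟨hp⟩
  have hcard' : Fintype.card (ZMod p ⊕ Fin q) = p + q := by
    rw [Fintype.card_sum, ZMod.card, Fintype.card_fin]
  let e₀ : α ≃ ZMod p ⊕ Fin q := Fintype.equivOfCardEq (hcard.trans hcard'.symm)
  have hx' : orderOf (e₀.permCongrHom x) = p :=
    (e₀.permCongrHom.orderOf_eq x).trans hx
  -- As 2p exceeds the degree, an element of order p is a single p-cycle, hence conjugate to the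
  -- model.
  have hc1 : (e₀.permCongrHom x).IsCycle :=
    Perm.isCycle_of_prime_order' (by rw [hx']; exact hp) (by rw [hx', hcard']; omega)
  have hc2 : (shiftPerm p q).IsCycle :=
    Perm.isCycle_of_prime_order' (by rw [orderOf_shiftPerm]; exact hp)
      (by rw [orderOf_shiftPerm, hcard']; omega)
  obtain ⟨r, hr⟩ := isConj_iff.1 (hc1.isConj hc2
    (by rw [← hc1.orderOf, ← hc2.orderOf, hx', orderOf_shiftPerm]))
  set e : α ≃ ZMod p ⊕ Fin q := e₀.trans r with he
  have hex : ∀ c, e (x c) = shiftPerm p q (e c) := by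
    intro c
    rw [← hr]
    simp [he]
  obtain ⟨Y, hsign, hYY, hinr, hm1, hne⟩ := exists_involution_model (p := p) (q := q) hqp
  have hey : ∀ c, e (e.symm.permCongrHom Y c) = Y (e c) := by
    intro c
    simp
  refine ⟨e.symm.permCongrHom Y, ?_, ?_, ?_, ?_, ?_⟩
  · rw [← hsign]; exact Perm.sign_permCongr e.symm Y
  · rw [← map_mul, hYY, map_one]
  · intro h
    rw [EmbeddingLike.map_eq_one_iff] at h
    rw [h] at hne
    exact hne rfl
  · intro H hxH hyH
    have htr := isPretransitive_of_shiftPerm_mem (H := H.map e.permCongrHom.toMonoidHom) (Y := Y)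
      ⟨x, hxH, by ext1 c; simp [hex]⟩ ⟨_, hyH, by ext1 c; simp⟩ hYY hinr
    refine ⟨fun u v => ?_⟩
    obtain ⟨⟨_, h, hh, rfl⟩, h1⟩ := htr.exists_smul_eq (e u) (e v)
    refine ⟨⟨h, hh⟩, e.injective ?_⟩
    rw [← h1]
    change e (h u) = (e.permCongrHom h) (e u)
    simp
  · rintro ⟨s, hs1, hs2⟩
    have hex' : ∀ c, e (x⁻¹ c) = (shiftPerm p q)⁻¹ (e c) := by
      intro c
      rw [eq_comm, Perm.inv_eq_iff_eq, ← hex]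
      simp
    have hes : ∀ c, e.permCongrHom s (e c) = e (s c) := by
      intro c
      simp
    refine not_exists_inverting_model hqp hq hYY hinr hm1 hne (e.permCongrHom s) ?_ ?_
    · intro c
      obtain ⟨c, rfl⟩ := e.surjective c
      rw [← hex, hes, hes, hs1, hex']
    · intro c
      obtain ⟨c, rfl⟩ := e.surjective c
      rw [← hey, hes, hes, hs2, hey]

end Involution

/-! ### The main theorem -/

theorem theorem1p4 (k n p : ℕ) (hk : 5 ≤ k)
    (hn : max 14 (6 * ⌈(k : ℚ) / 2⌉ - 12) ≤ (n : ℤ))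
    (hp : p.Prime) (hp_lower : ((n : ℚ) + 4) / 2 < (p : ℚ)) (hp_upper : (p : ℤ) ≤ (n : ℤ) - 3)
    (x : alternatingGroup (Fin n)) (hx : orderOf x = p) :
    ∃ y : alternatingGroup (Fin n), orderOf y = 2 ∧
      IsGRR (gammaGraph k x y) (alternatingGroup (Fin n)) := by
  have hn14 : 14 ≤ n := by
    have := (le_max_left _ _).trans hn
    omega
  have hpn : n + 4 < 2 * p := by
    rw [div_lt_iff₀ (by norm_num)] at hp_lower
    have : ((n + 4 : ℕ) : ℚ) < ((2 * p : ℕ) : ℚ) := by push_cast; linarith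
    exact_mod_cast this
  have hceil : (((k - 1) / 2 : ℕ) : ℤ) + 1 ≤ ⌈(k : ℚ) / 2⌉ := by
    have h1 : (((k - 1) / 2 : ℕ) : ℤ) < ⌈(k : ℚ) / 2⌉ := by
      rw [Int.lt_ceil, lt_div_iff₀ (by norm_num)]
      have : (k - 1) / 2 * 2 < k := by omega
      exact_mod_cast this
    omega
  have hkn : 6 * ((k - 1) / 2) ≤ n + 6 := by
    have := (le_max_right _ _).trans hn
    omega
  have hkp : 3 * ((k - 1) / 2) < p := by
    -- With m = (k - 1) / 2, 2p > n + 4 ≥ 6m - 2 gives p ≥ 3m by parity; equality is impossible for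
    -- a prime p > 3.
    have h1 : 3 * ((k - 1) / 2) ≤ p := by omega
    refine lt_of_le_of_ne h1 fun h2 => ?_
    have h3 : 3 ∣ p := ⟨_, h2.symm⟩
    rw [Nat.prime_dvd_prime_iff_eq Nat.prime_three hp] at h3
    omega
  have hxp : orderOf (x : Equiv.Perm (Fin n)) = p := by rw [Subgroup.orderOf_coe, hx]
  have hxc : (x : Equiv.Perm (Fin n)).IsCycle :=
    Equiv.Perm.isCycle_of_prime_order' (by rw [hxp]; exact hp)
      (by rw [hxp, Fintype.card_fin]; omega)
  have hsupp : (x : Equiv.Perm (Fin n)).support.card = p := by rw [← hxc.orderOf, hxp]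
  -- The requirement q + 5 ≤ p for q = n - p is exactly n + 4 < 2p.
  obtain ⟨y, hsign, hyy, hy1, htrans, hno⟩ := exists_involution (α := Fin n) (p := p) (q := n - p) hp
    (by rw [Fintype.card_fin]; omega) (by omega) (by omega) hxp
  have hyA : y ∈ alternatingGroup (Fin n) := Equiv.Perm.mem_alternatingGroup.2 hsign
  have hy2 : orderOf (⟨y, hyA⟩ : alternatingGroup (Fin n)) = 2 := by
    rw [Subgroup.orderOf_mk]
    exact orderOf_eq_prime (by rw [pow_two, hyy]) hy1
  have hgen : Subgroup.closure {x, (⟨y, hyA⟩ : alternatingGroup (Fin n))} = ⊤ := by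
    have hmap : (Subgroup.closure {x, (⟨y, hyA⟩ : alternatingGroup (Fin n))}).map
        (alternatingGroup (Fin n)).subtype = Subgroup.closure {(x : Equiv.Perm (Fin n)), y} := by
      rw [MonoidHom.map_closure, Set.image_pair]
      rfl
    have hxH : (x : Equiv.Perm (Fin n)) ∈ Subgroup.closure {(x : Equiv.Perm (Fin n)), y} :=
      Subgroup.subset_closure (Or.inl rfl)
    have hyH : y ∈ Subgroup.closure {(x : Equiv.Perm (Fin n)), y} :=
      Subgroup.subset_closure (Or.inr rfl)
    have := htrans _ hxH hyH
    have hle := alternatingGroup_le_of_isCycle_mem hxH hxc (by rw [hsupp]; exact hp)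
      (by rw [hsupp, Fintype.card_fin]; omega) (by rw [hsupp, Fintype.card_fin]; omega)
    rw [eq_top_iff]
    intro g _
    have hg := hle g.2
    rw [← hmap] at hg
    obtain ⟨g', hg', h⟩ := hg
    have : g' = g := Subtype.ext h
    rwa [← this]
  have hsimple : IsSimpleGroup (alternatingGroup (Fin n)) :=
    alternatingGroup.isSimpleGroup (by rw [Nat.card_eq_fintype_card, Fintype.card_fin]; omega)
  refine ⟨⟨y, hyA⟩, hy2, isGRR_gammaGraph hk hp (by omega) hkp hx hy2 hgen ?_⟩
  rintro ⟨φ, hφx, hφy⟩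
  obtain ⟨s, hs⟩ := exists_perm_of_mulEquiv hxc (by rw [hsupp]; exact hp)
    (by rw [hsupp, Fintype.card_fin]; omega) (by rw [hsupp, Fintype.card_fin]; omega) φ hφx
  refine hno ⟨s, fun c => ?_, fun c => ?_⟩
  · have := hs x c
    rw [hφx] at this
    exact this
  · have := hs ⟨y, hyA⟩ c
    rw [hφy] at this
    exact this
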